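/- Let $\Lambda$ be an index set, let $H=\ell^2(\Lambda)$ be the complex Hilbert space with standard orthonormal basis $(e_i)_{i\in\Lambda}$, and let $\mathcal F(H)=\bigoplus_{n\ge 0}H^{\otimes n}$ be its full Fock space with vacuum vector $1\in H^{\otimes 0}=\mathbb C$. For $x\in H$ let $L(x)y=x\otimes y$, and let $\mathfrak A_d\subseteq B(\mathcal F(H))$, $d=|\Lambda|$, be the norm closed unital algebra generated by $\{L(x):x\in H\}$ (the noncommutative disc algebra). An operator $f$ on $\mathcal F(H)$ is $n$-homogeneous if it maps $H^{\otimes m}$ into $H^{\otimes(m+n)}$ for all $m$; the $n$-homogeneous component $f_n$ of $f\in\mathfrak A_d$ is the $n$-homogeneous operator for which $f_ny$ is the component of $fy$ in $H^{\otimes(m+n)}$ for all $m$ and $y\in H^{\otimes m}$. For $f\in\mathfrak A_d$ with $f\cdot 1=\sum_w a_w e_w$ (the sum over words $w=i_1\cdots i_n$ in $\Lambda$, $e_w=e_{i_1}\otimes\cdots\otimes e_{i_n}$) and $z=(z_i)_{i\in\Lambda}\in H$ with $\|z\|<1$ let $f(z)=\sum_w a_w z_{i_1}\cdots z_{i_n}$;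 this function extends continuously (in norm) to the closed unit ball $\overline{\mathbb B}_d$ of $H$, and the extension is again denoted by $f$. Let $J$ be a two-sided ideal of $\mathfrak A_d$ that is homogeneous, that is, $f_n\in J$ for all $f\in J$ and $n\ge 0$. Put $$\overline Z(J)=\{z\in\overline{\mathbb B}_d: f(z)=0\text{ for all }f\in J\},$$ with the relative weak topology of $H$. Let $X=X^J=(X_n)_{n\ge0}$ with $$X_n=H^{\otimes n}\ominus\{f\cdot 1: f\in J\text{ is }n\text{-homogeneous}\},$$ let $\mathcal F_X=\bigoplus_n X_n\subseteq\mathcal F(H)$, let $p_n$ be the orthogonal projection of $H^{\otimes n}$ onto $X_n$, and for $x\in X_1$ let $S(x)\in B(\mathcal F_X)$ be the shift $S(x)y=p_{n+1}(x\otimes y)$, $y\in X_n$. Let $\mathcal A_X\subseteq B(\mathcal F_X)$ be the norm closed unital algebra generated by $\{S(x):x\in X_1\}$ (the tensor algebra of $X$), and let $S_i=S(p_1e_i)$ for $i\in\Lambda$ (so $S_i=S(e_i)$ if $X_1=H$). Let $\mathcal M(\mathcal A_X)$ be the character space of $\mathcal A_X$, i.e. the space of nonzero (automatically continuous) homomorphisms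 $\mathcal A_X\to\mathbb C$, with the weak-$*$ topology. Then $$\mathcal M(\mathcal A_X)\to\overline Z(J),\qquad \chi\mapsto(\chi(S_i))_{i\in\Lambda},$$ is well defined and a homeomorphism. -/

import Mathlib

open scoped InnerProductSpace Topology

noncomputable section

namespace FockSpace

/-! ### The full Fock space and the left creation operators -/

/-- The Hilbert space `H = ℓ²(Λ)`, with its standard orthonormal basis `(e_i)_{i ∈ Λ}`. -/
abbrev BaseSpace (Λ : Type*) : Type _ := lp (fun _ : Λ => ℂ) 2

/-- The full Fock space `F(H) = ⨁ₙ H^{⊗ n}` over `H = ℓ²(Λ)`, realised as `ℓ²` of the set of all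
words in the alphabet `Λ`.  The word `[i₁, …, iₙ]` corresponds to the basis vector
`e_{i₁} ⊗ ⋯ ⊗ e_{iₙ}`. -/
abbrev FullFock (Λ : Type*) : Type _ := lp (fun _ : List Λ => ℂ) 2

open Classical in
/-- The orthonormal basis vector `e_w = e_{i₁} ⊗ ⋯ ⊗ e_{iₙ}` for a word `w = [i₁, …, iₙ]`. -/
def basisVec {Λ : Type*} (w : List Λ) : FullFock Λ := lp.single 2 w (1 : ℂ)

/-- The vacuum vector `1 ∈ H^{⊗ 0} = ℂ`. -/
def vacuum (Λ : Type*) : FullFock Λ := basisVec []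

theorem lp_eval_continuous {ι : Type*} (i : ι) :
    Continuous fun x : lp (fun _ : ι => ℂ) 2 => x i :=
  (lp.evalCLM ℂ (fun _ : ι => ℂ) 2 i).continuous

/-- The summand `H^{⊗ n}` of the full Fock space: the vectors supported on words of length `n`. -/
def tensorPower (Λ : Type*) (n : ℕ) : ClosedSubmodule ℂ (FullFock Λ) where
  carrier := {x | ∀ w : List Λ, w.length ≠ n → x w = 0}
  add_mem' := by
    intro x y hx hy w hw
    simp [hx w hw, hy w hw]
  zero_mem' := by
    intro w _
    simp
  smul_mem' := by
    intro c x hx w hw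
    simp [hx w hw]
  isClosed' := by
    have h : {x : FullFock Λ | ∀ w : List Λ, w.length ≠ n → x w = 0}
        = ⋂ w : List Λ, ⋂ _ : w.length ≠ n, {x : FullFock Λ | x w = 0} := by
      ext x
      simp
    change IsClosed {x : FullFock Λ | ∀ w : List Λ, w.length ≠ n → x w = 0}
    rw [h]
    exact isClosed_iInter fun w => isClosed_iInter fun _ =>
      isClosed_eq (lp_eval_continuous w) continuous_const

/-- The coordinates of `ξ ⊗ y`, where only the degree one part of `ξ` is used:
`(ξ ⊗ y)(i :: u) = ξ(i) * y(u)` and `(ξ ⊗ y)(∅) = 0`. -/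
def creationFun {Λ : Type*} (ξ y : List Λ → ℂ) : List Λ → ℂ
  | [] => 0
  | i :: u => ξ [i] * y u

theorem lp_two_hasSum {ι : Type*} (x : lp (fun _ : ι => ℂ) 2) :
    HasSum (fun i => ‖x i‖ ^ 2) (‖x‖ ^ 2) := by
  have h := lp.hasSum_norm (p := 2) (by norm_num) x
  simpa using h

theorem summable_letters {Λ : Type*} (ξ : FullFock Λ) :
    Summable (fun i : Λ => ‖ξ [i]‖ ^ 2) :=
  (lp_two_hasSum ξ).summable.comp_injective (i := fun i : Λ => [i]) fun a b h => by simpa using h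

theorem creationFun_hasSum {Λ : Type*} (ξ y : FullFock Λ) :
    HasSum (fun w => ‖creationFun ξ y w‖ ^ 2) ((∑' i : Λ, ‖ξ [i]‖ ^ 2) * ‖y‖ ^ 2) := by
  have h1 := summable_letters ξ
  have h2 := lp_two_hasSum y
  have h3 : Summable fun p : Λ × List Λ => ‖ξ [p.1]‖ ^ 2 * ‖y p.2‖ ^ 2 :=
    h1.mul_of_nonneg h2.summable (fun _ => by positivity) (fun _ => by positivity)
  have h4 := h1.hasSum.mul h2 h3
  have hc : Function.Injective (fun p : Λ × List Λ => p.1 :: p.2) := by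
    rintro ⟨a, u⟩ ⟨b, v⟩ h
    simpa using h
  refine (hc.hasSum_iff ?_).1 ?_
  · intro w hw
    cases w with
    | nil => simp [creationFun]
    | cons i u => exact absurd ⟨(i, u), rfl⟩ hw
  · have h5 : ((fun w => ‖creationFun ξ y w‖ ^ 2) ∘ fun p : Λ × List Λ => p.1 :: p.2)
        = fun p : Λ × List Λ => ‖ξ [p.1]‖ ^ 2 * ‖y p.2‖ ^ 2 := by
      funext p
      simp [creationFun, mul_pow]
    rw [h5]
    exact h4

theorem creationFun_memℓp {Λ : Type*} (ξ y : FullFock Λ) :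
    Memℓp (E := fun _ : List Λ => ℂ) (creationFun ξ y) 2 := by
  refine memℓp_gen ?_
  simpa using (creationFun_hasSum ξ y).summable

/-- The left creation operator `L(ξ) : y ↦ ξ ⊗ y` on the full Fock space, for `ξ ∈ H = H^{⊗ 1}`.
(For a general vector `ξ` of the full Fock space, `creation ξ` is the creation operator of the
degree one part of `ξ`.) -/
def creation {Λ : Type*} (ξ : FullFock Λ) : FullFock Λ →L[ℂ] FullFock Λ :=
  LinearMap.mkContinuous
    { toFun := fun y => ⟨creationFun ξ y, creationFun_memℓp ξ y⟩
      map_add' := by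
        intro x y
        ext w
        change creationFun ξ (x + y : FullFock Λ) w = creationFun ξ x w + creationFun ξ y w
        cases w <;> simp [creationFun, mul_add]
      map_smul' := by
        intro c y
        ext w
        cases w <;> simp [creationFun, mul_left_comm] }
    ‖ξ‖ (by
      intro y
      have h1 := lp_two_hasSum (⟨creationFun ξ y, creationFun_memℓp ξ y⟩ : FullFock Λ)
      have h2 := h1.unique (creationFun_hasSum ξ y)
      have h3 : ∑' i : Λ, ‖ξ [i]‖ ^ 2 ≤ ‖ξ‖ ^ 2 := by
        rw [← (lp_two_hasSum ξ).tsum_eq]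
        exact (summable_letters ξ).tsum_le_tsum_of_inj (fun i : Λ => [i])
          (fun a b h => by simpa using h) (fun _ _ => by positivity) (fun _ => le_rfl)
          (lp_two_hasSum ξ).summable
      refine le_of_sq_le_sq ?_ (by positivity)
      rw [mul_pow]
      calc _ = (∑' i : Λ, ‖ξ [i]‖ ^ 2) * ‖y‖ ^ 2 := h2
        _ ≤ _ := by gcongr)

/-- The norm closed unital operator algebra generated by a set of operators on a Hilbert space. -/
def closedAlgebra {E : Type*} [NormedAddCommGroup E] [InnerProductSpace ℂ E]
    (s : Set (E →L[ℂ] E)) : Subalgebra ℂ (E →L[ℂ] E) :=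
  (Algebra.adjoin ℂ s).topologicalClosure

theorem subset_closedAlgebra {E : Type*} [NormedAddCommGroup E] [InnerProductSpace ℂ E]
    {s : Set (E →L[ℂ] E)} {T : E →L[ℂ] E} (hT : T ∈ s) : T ∈ closedAlgebra s :=
  Subalgebra.le_topologicalClosure _ (Algebra.subset_adjoin hT)

/-! ### The noncommutative disc algebra and its homogeneous ideals -/

/-- The noncommutative disc algebra `𝔄_d`, `d = |Λ|`: the tensor algebra of the full product system
`(H^{⊗ n})ₙ`, i.e. the norm closed unital algebra generated by the operators `L(ξ)`, `ξ ∈ H`. -/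
def discAlgebra (Λ : Type*) : Subalgebra ℂ (FullFock Λ →L[ℂ] FullFock Λ) :=
  closedAlgebra {T | ∃ ξ ∈ tensorPower Λ 1, T = creation ξ}

/-- An operator on the full Fock space is `n`-homogeneous if it maps `H^{⊗ m}` into
`H^{⊗ (m + n)}` for all `m`. -/
def IsHomogeneousOperator {Λ : Type*} (n : ℕ) (T : FullFock Λ →L[ℂ] FullFock Λ) : Prop :=
  ∀ m : ℕ, ∀ y ∈ tensorPower Λ m, T y ∈ tensorPower Λ (m + n)

/-- `g` is the `n`-homogeneous component of `f`: `g` is `n`-homogeneous, and for `y ∈ H^{⊗ m}` the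
vector `g y` is the component of `f y` in `H^{⊗ (m + n)}`. -/
def IsHomogeneousComponent {Λ : Type*} (n : ℕ) (f g : FullFock Λ →L[ℂ] FullFock Λ) : Prop :=
  IsHomogeneousOperator n g ∧
    ∀ m : ℕ, ∀ y ∈ tensorPower Λ m, ∀ w : List Λ, w.length = m + n → g y w = f y w

/-- A (two-sided) ideal of the noncommutative disc algebra is homogeneous if it contains all
homogeneous components of its elements. -/
def IsHomogeneousIdeal {Λ : Type*} (J : TwoSidedIdeal (discAlgebra Λ)) : Prop :=
  ∀ f ∈ J, ∀ n : ℕ, ∃ g ∈ J,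
    IsHomogeneousComponent n (f : FullFock Λ →L[ℂ] FullFock Λ) (g : FullFock Λ →L[ℂ] FullFock Λ)

/-! ### Fock spaces, shifts and tensor algebras of families of fibres -/

/-- The Fock space `F_X = ⨁ₙ Xₙ` of a family of closed subspaces `Xₙ ⊆ H^{⊗ n}`, as a closed
subspace of the full Fock space. -/
def fockSpace {Λ : Type*} (X : ℕ → ClosedSubmodule ℂ (FullFock Λ)) : Submodule ℂ (FullFock Λ) :=
  (⨆ n : ℕ, (X n).toSubmodule).topologicalClosure

instance {Λ : Type*} (X : ℕ → ClosedSubmodule ℂ (FullFock Λ)) : CompleteSpace (fockSpace X) :=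
  (Submodule.isClosed_topologicalClosure _).completeSpace_coe

/-- The shift `S(ξ)` on `F_X`.  If `ξ ∈ X₁` and `y ∈ Xₙ`, then `ξ ⊗ y ∈ H^{⊗ (n + 1)}`, so that the
orthogonal projection onto `F_X` acts on `ξ ⊗ y` as the projection `p_{n+1}` onto `X_{n+1}`: see
`shift_apply_of_mem`. -/
def shift {Λ : Type*} (X : ℕ → ClosedSubmodule ℂ (FullFock Λ)) (ξ : FullFock Λ) :
    fockSpace X →L[ℂ] fockSpace X :=
  (fockSpace X).orthogonalProjectionOnto ∘L creation ξ ∘L (fockSpace X).subtypeL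

theorem shift_apply_of_mem {Λ : Type*} (X : ℕ → ClosedSubmodule ℂ (FullFock Λ))
    (hX : ∀ n, X n ≤ tensorPower Λ n) (ξ : FullFock Λ) (n : ℕ) (y : fockSpace X)
    (hy : (y : FullFock Λ) ∈ X n) :
    (shift X ξ y : FullFock Λ)
      = (X (n + 1)).toSubmodule.starProjection (creation ξ (y : FullFock Λ)) := by
  have hy' : ∀ w : List Λ, w.length ≠ n + 1 → creation ξ (y : FullFock Λ) w = 0 := by
    intro w hw
    cases w with
    | nil => rfl
    | cons i u =>
      change ξ [i] * (y : FullFock Λ) u = 0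
      rw [hX n hy u (by simpa using hw), mul_zero]
  have hdis : ∀ m, m ≠ n + 1 → ∀ a b : FullFock Λ, a ∈ tensorPower Λ m →
      (∀ w : List Λ, w.length ≠ n + 1 → b w = 0) → inner ℂ a b = 0 := by
    intro m hm a b ha hb
    rw [lp.inner_eq_tsum]
    have h0 : ∀ w : List Λ, inner ℂ (a w) (b w) = 0 := by
      intro w
      by_cases hw : w.length = n + 1
      · rw [ha w (by omega), inner_zero_left]
      · rw [hb w hw, inner_zero_right]
    simp only [h0, tsum_zero]
  change (fockSpace X).starProjection (creation ξ (y : FullFock Λ)) = _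
  symm
  set v := creation ξ (y : FullFock Λ) with hv
  set p := (X (n + 1)).toSubmodule.starProjection v with hp
  have hpm : p ∈ (X (n + 1)).toSubmodule := Submodule.starProjection_apply_mem _ _
  have hpF : p ∈ fockSpace X :=
    Submodule.le_topologicalClosure _ (Submodule.mem_iSup_of_mem (n + 1) hpm)
  refine (Submodule.eq_starProjection_of_mem_orthogonal hpF ?_).symm
  rw [fockSpace, Submodule.orthogonal_closure, ← Submodule.iInf_orthogonal,
    Submodule.mem_iInf]
  intro m
  by_cases hm : m = n + 1
  · subst hm
    exact Submodule.sub_starProjection_mem_orthogonal v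
  · intro a ha
    refine hdis m hm a _ (hX m ha) fun w hw => ?_
    have h1 : p w = 0 := hX (n + 1) hpm w hw
    change v w - p w = 0
    rw [hy' w hw, h1, sub_zero]

/-- The tensor algebra `𝒜_X`: the norm closed unital subalgebra of `B(F_X)` generated by the shifts
`S(ξ)`, `ξ ∈ X₁`. -/
def tensorAlgebra {Λ : Type*} (X : ℕ → ClosedSubmodule ℂ (FullFock Λ)) :
    Subalgebra ℂ (fockSpace X →L[ℂ] fockSpace X) :=
  closedAlgebra {T | ∃ ξ ∈ X 1, T = shift X ξ}

/-- The element `S_i` of the tensor algebra: the shift by `p₁ e_i`, which is `S(e_i)` when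
`X₁ = H`. -/
def shiftGen {Λ : Type*} (X : ℕ → ClosedSubmodule ℂ (FullFock Λ)) (i : Λ) : tensorAlgebra X :=
  ⟨shift X ((X 1).toSubmodule.starProjection (basisVec [i])),
    subset_closedAlgebra
      ⟨_, Submodule.starProjection_apply_mem (X 1).toSubmodule (basisVec [i]), rfl⟩⟩

/-- The family `X^J`: its `n`-th fibre is the orthogonal complement in `H^{⊗ n}` of the
`n`-homogeneous elements of `J`, where `f` is identified with the vector `f 1` of the full Fock
space. -/
def idealFibre {Λ : Type*} (J : TwoSidedIdeal (discAlgebra Λ)) (n : ℕ) :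
    ClosedSubmodule ℂ (FullFock Λ) :=
  tensorPower Λ n ⊓
    { toSubmodule := (Submodule.span ℂ {x : FullFock Λ | ∃ f ∈ J,
        IsHomogeneousOperator n (f : FullFock Λ →L[ℂ] FullFock Λ) ∧
          x = (f : FullFock Λ →L[ℂ] FullFock Λ) (vacuum Λ)})ᗮ
      isClosed' := Submodule.isClosed_orthogonal _ }

/-! ### Scalar zero sets -/

/-- The value of `f` at a point `z` of the open unit ball of `H`: with `f 1 = ∑_w a_w e_w`, this is
the value of the power series `∑_w a_w z^w`, where `z^w = z_{i₁} ⋯ z_{iₙ}` for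
`w = [i₁, …, iₙ]`. -/
def ballEval {Λ : Type*} (f : FullFock Λ →L[ℂ] FullFock Λ) (z : BaseSpace Λ) : ℂ :=
  ∑' w : List Λ, f (vacuum Λ) w * (w.map fun i => z i).prod

/-- The value of `f` at a point `z` of the closed unit ball, by continuous extension (in the norm
topology) of the function `f` on the open unit ball. -/
def scalarEval {Λ : Type*} (f : FullFock Λ →L[ℂ] FullFock Λ) (z : BaseSpace Λ) : ℂ :=
  extendFrom (Metric.ball (0 : BaseSpace Λ) 1) (ballEval f) z

/-- The scalar zero set of `J` in the closed unit ball of `H`, as a subset of `H` with the weak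
topology. -/
def zeroSet {Λ : Type*} (J : TwoSidedIdeal (discAlgebra Λ)) : Set (WeakSpace ℂ (BaseSpace Λ)) :=
  (toWeakSpace ℂ (BaseSpace Λ)).symm ⁻¹'
    {z | z ∈ Metric.closedBall (0 : BaseSpace Λ) 1 ∧
      ∀ f ∈ J, scalarEval (f : FullFock Λ →L[ℂ] FullFock Λ) z = 0}

end FockSpace

end

open scoped InnerProductSpace Topology

noncomputable section

namespace FockSpace

/-! ### Closed operator algebras and their characters -/

section ClosedAlgebra

variable {E : Type*} [NormedAddCommGroup E] [InnerProductSpace ℂ E] {s : Set (E →L[ℂ] E)}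

/-! Characters are contractive, so both equality and pointwise convergence of characters can be
tested on generators. Evaluations at points come from eigenvectors. For ‖z‖ < 1 the vector k_z = ∑_w
conj(z^w) e_w is an eigenvector of every L(ξ)*, and the eigenvalue gives the character f ↦ f(z).
Points of norm 1 are reached from rz, r → 1, by compactness of the character space. Conversely, a
character ψ of 𝔄_d gives the contractive functional x ↦ ψ(L(x)), hence by Riesz a point of the
closed ball, and ψ is evaluation there (`ballCharacter_characterPoint`).

Let K be the closed span of the vectors f·1 with f in J homogeneous. Then F_X = Kᗮ (`fockSpace_eq`),
and since J is a homogeneous two-sided ideal, 𝔄_d leaves K invariant and J maps everything into K.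
So compression to F_X is a homomorphism 𝔄_d → 𝒜_X that kills J and sends L(ξ) to S(ξ)
(`compress_mul`, `compressHom_eq_zero`). Characters of 𝒜_X therefore pull back to evaluations at
points of the zero set, injectively because the S(ξ) generate. For surjectivity, a zero z of J
satisfies f(rz) = r^n f(z) = 0 for n-homogeneous f in J, so k_{rz} lies in F_X and is an eigenvector
of every S(ξ)*; then r → 1 (`exists_pullback_eq`).

Finally χ(S(x)) = ⟪star x, z⟫ for the point z of χ, so weak-* convergence on generators is weak
convergence of points. -/

theorem isClosed_closedAlgebra : IsClosed (closedAlgebra s : Set (E →L[ℂ] E)) :=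
  Subalgebra.isClosed_topologicalClosure _

instance closedAlgebra_completeSpace [CompleteSpace E] : CompleteSpace (closedAlgebra s) :=
  isClosed_closedAlgebra.completeSpace_coe

/-- A generator, as an element of the closed algebra. -/
def closedAlgebraGen (T : E →L[ℂ] E) (hT : T ∈ s) : closedAlgebra s :=
  ⟨T, subset_closedAlgebra hT⟩

/-- Induction principle for closed algebras: a property that cuts out a closed subalgebra need only
be checked on generators. -/
theorem closedAlgebra_subalgebra_eq_top (A : Subalgebra ℂ (closedAlgebra s))
    (hA : IsClosed (A : Set (closedAlgebra s)))
    (h : ∀ T (hT : T ∈ s), closedAlgebraGen T hT ∈ A) (f : closedAlgebra s) : f ∈ A := by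
  have hle : closedAlgebra s ≤ A.map (closedAlgebra s).val := by
    refine Subalgebra.topologicalClosure_minimal (Algebra.adjoin_le fun T hT => ?_) ?_
    · exact ⟨closedAlgebraGen T hT, h T hT, rfl⟩
    · exact isClosed_closedAlgebra.isClosedEmbedding_subtypeVal.isClosedMap _ hA
  obtain ⟨g, hg, hgf⟩ := hle f.2
  rwa [← Subtype.ext hgf]

theorem norm_one_closedAlgebra_le : ‖(1 : closedAlgebra s)‖ ≤ 1 :=
  ContinuousLinearMap.norm_id_le

/-- χ f lies in the spectrum of f. Only ‖1‖ ≤ 1 is available, since E may be trivial. -/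
theorem norm_character_apply_le [CompleteSpace E]
    (χ : WeakDual.characterSpace ℂ (closedAlgebra s)) (f : closedAlgebra s) : ‖χ f‖ ≤ ‖f‖ :=
  (spectrum.norm_le_norm_mul_of_mem (WeakDual.CharacterSpace.apply_mem_spectrum χ f)).trans
    (mul_le_of_le_one_right (norm_nonneg f) norm_one_closedAlgebra_le)

theorem continuous_character_apply (f : closedAlgebra s) :
    Continuous fun χ : WeakDual.characterSpace ℂ (closedAlgebra s) => χ f :=
  (WeakDual.eval_continuous f).comp continuous_subtype_val

/-- Characters of a closed algebra that converge on its generators converge everywhere. -/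
theorem tendsto_character [CompleteSpace E] {α : Type*} {l : Filter α}
    {χ : α → WeakDual.characterSpace ℂ (closedAlgebra s)}
    {ψ : WeakDual.characterSpace ℂ (closedAlgebra s)}
    (h : ∀ T (hT : T ∈ s), Filter.Tendsto (fun a => χ a (closedAlgebraGen T hT)) l
      (𝓝 (ψ (closedAlgebraGen T hT)))) (f : closedAlgebra s) :
    Filter.Tendsto (fun a => χ a f) l (𝓝 (ψ f)) := by
  let A : Subalgebra ℂ (closedAlgebra s) :=
    { carrier := {f | Filter.Tendsto (fun a => χ a f) l (𝓝 (ψ f))}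
      mul_mem' := fun {f g} hf hg => by
        have := Filter.Tendsto.mul hf hg
        simpa using this
      add_mem' := fun {f g} hf hg => by
        have := Filter.Tendsto.add hf hg
        simpa using this
      algebraMap_mem' := fun c => by
        have h1 : ∀ φ : WeakDual.characterSpace ℂ (closedAlgebra s),
          φ (algebraMap ℂ _ c) = c := fun φ => AlgHomClass.commutes φ c
        simp only [Set.mem_ofPred_eq, h1]
        exact tendsto_const_nhds }
  refine closedAlgebra_subalgebra_eq_top A ?_ h f
  -- An ε/3 argument: the uniform bound ‖φ‖ ≤ 1 over all characters makes the set of good f closed.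
  refine isClosed_of_closure_subset fun f hf => ?_
  change Filter.Tendsto (fun a => χ a f) l (𝓝 (ψ f))
  rw [Metric.tendsto_nhds]
  intro ε hε
  obtain ⟨g, hg, hfg⟩ := Metric.mem_closure_iff.1 hf (ε / 3) (by positivity)
  have hg' : Filter.Tendsto (fun a => χ a g) l (𝓝 (ψ g)) := hg
  filter_upwards [Metric.tendsto_nhds.1 hg' (ε / 3) (by positivity)] with a ha
  have h1 : ∀ φ : WeakDual.characterSpace ℂ (closedAlgebra s), dist (φ f) (φ g) < ε / 3 := by
    intro φ
    rw [dist_eq_norm, ← map_sub]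
    exact (norm_character_apply_le φ _).trans_lt (by rwa [← dist_eq_norm])
  have h2 := h1 (χ a)
  have h3 := h1 ψ
  rw [dist_comm] at h3
  linarith [dist_triangle4 (χ a f) (χ a g) (ψ g) (ψ f)]

theorem character_ext [CompleteSpace E] {χ ψ : WeakDual.characterSpace ℂ (closedAlgebra s)}
    (h : ∀ T (hT : T ∈ s), χ (closedAlgebraGen T hT) = ψ (closedAlgebraGen T hT)) : χ = ψ := by
  refine DFunLike.ext _ _ fun f => ?_
  have := tendsto_character (l := (⊤ : Filter Unit)) (χ := fun _ => χ) (ψ := ψ)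
    (fun T hT => by rw [h T hT]; exact tendsto_const_nhds) f
  exact tendsto_nhds_unique tendsto_const_nhds this

/-- If the functional `⟪k, ·⟫` is an eigenvector of the transposes of all generators, then it is an
eigenvector of the transposes of all elements of the closed algebra. -/
theorem exists_eigenvalue {k : E} (hk : k ≠ 0)
    (h : ∀ T ∈ s, ∃ c : ℂ, ∀ y, ⟪k, T y⟫_ℂ = c * ⟪k, y⟫_ℂ) (f : closedAlgebra s) :
    ∃ c : ℂ, ∀ y, ⟪k, (f : E →L[ℂ] E) y⟫_ℂ = c * ⟪k, y⟫_ℂ := by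
  have hkk : ⟪k, k⟫_ℂ ≠ 0 := inner_self_ne_zero.2 hk
  let A : Subalgebra ℂ (closedAlgebra s) :=
    { carrier := {f | ∃ c : ℂ, ∀ y, ⟪k, (f : E →L[ℂ] E) y⟫_ℂ = c * ⟪k, y⟫_ℂ}
      mul_mem' := by
        rintro f g ⟨a, ha⟩ ⟨b, hb⟩
        exact ⟨a * b, fun y => by simp [ha, hb, mul_assoc]⟩
      add_mem' := by
        rintro f g ⟨a, ha⟩ ⟨b, hb⟩
        exact ⟨a + b, fun y => by simp [ha, hb, add_mul]⟩
      algebraMap_mem' := fun c => ⟨c, fun y => by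
        simp [Algebra.algebraMap_eq_smul_one]⟩ }
  refine closedAlgebra_subalgebra_eq_top A ?_ (fun T hT => h T hT) f
  -- An eigenvalue can only be ⟪k, f k⟫ / ⟪k, k⟫; inserting it turns the existential into equations
  -- that are closed in f.
  have hA : (A : Set (closedAlgebra s)) = ⋂ y : E, {f : closedAlgebra s |
      ⟪k, (f : E →L[ℂ] E) y⟫_ℂ * ⟪k, k⟫_ℂ = ⟪k, (f : E →L[ℂ] E) k⟫_ℂ * ⟪k, y⟫_ℂ} := by
    ext f
    simp only [Set.mem_iInter, Set.mem_ofPred_eq]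
    constructor
    · rintro ⟨c, hc⟩ y
      rw [hc, hc]
      ring
    · intro hf
      refine ⟨⟪k, (f : E →L[ℂ] E) k⟫_ℂ / ⟪k, k⟫_ℂ, fun y => ?_⟩
      rw [div_mul_eq_mul_div, ← hf y, mul_div_cancel_right₀ _ hkk]
  rw [hA]
  refine isClosed_iInter fun y => isClosed_eq ?_ ?_ <;> fun_prop

/-- The character defined by an eigenvector as in `exists_eigenvalue`. -/
theorem exists_character_of_eigenvector [CompleteSpace E] {k : E} (hk : k ≠ 0)
    (h : ∀ T ∈ s, ∃ c : ℂ, ∀ y, ⟪k, T y⟫_ℂ = c * ⟪k, y⟫_ℂ) :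
    ∃ χ : WeakDual.characterSpace ℂ (closedAlgebra s), ∀ (f : closedAlgebra s) (y : E),
      ⟪k, (f : E →L[ℂ] E) y⟫_ℂ = χ f * ⟪k, y⟫_ℂ := by
  have hkk : ⟪k, k⟫_ℂ ≠ 0 := inner_self_ne_zero.2 hk
  choose c hc using exists_eigenvalue hk h
  -- The eigenvalue is unique, so every algebraic law for `c` follows by exhibiting the expected
  -- one.
  have key : ∀ (f : closedAlgebra s) (d : ℂ), ⟪k, (f : E →L[ℂ] E) k⟫_ℂ = d * ⟪k, k⟫_ℂ → c f = d :=
    fun f d hd => mul_right_cancel₀ hkk ((hc f k).symm.trans hd)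
  let φ : closedAlgebra s →ₐ[ℂ] ℂ :=
    { toFun := c
      map_one' := key _ _ (by simp)
      map_mul' := fun f g => key _ _ (by simp [hc, mul_assoc])
      map_zero' := key _ _ (by simp)
      map_add' := fun f g => key _ _ (by simp [hc, add_mul])
      commutes' := fun a => key _ _ (by
        simp [Algebra.algebraMap_eq_smul_one]) }
  exact ⟨WeakDual.CharacterSpace.equivAlgHom.symm φ, hc⟩

/-- A function on the generators is the restriction of a character if, for all `r < 1`, its
multiple by `r` is given by eigenvectors. -/
theorem exists_character_of_eigenvectors [CompleteSpace E] {k : ℝ → E}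
    (hk : ∀ r, 0 < r → r < 1 → k r ≠ 0)
    (h : ∀ T ∈ s, ∃ c : ℂ, ∀ r, 0 < r → r < 1 → ∀ y, ⟪k r, T y⟫_ℂ = r * c * ⟪k r, y⟫_ℂ) :
    ∃ χ : WeakDual.characterSpace ℂ (closedAlgebra s), ∀ T (hT : T ∈ s) (c : ℂ),
      (∀ r, 0 < r → r < 1 → ∀ y, ⟪k r, T y⟫_ℂ = r * c * ⟪k r, y⟫_ℂ) →
        χ (closedAlgebraGen T hT) = c := by
  have h1 : ∀ r : Set.Ioo (0 : ℝ) 1, ∃ χ : WeakDual.characterSpace ℂ (closedAlgebra s),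
      ∀ T (hT : T ∈ s) (c : ℂ),
        (∀ r, 0 < r → r < 1 → ∀ y, ⟪k r, T y⟫_ℂ = r * c * ⟪k r, y⟫_ℂ) →
          χ (closedAlgebraGen T hT) = r * c := by
    rintro ⟨r, hr0, hr1⟩
    have hkk : ⟪k r, k r⟫_ℂ ≠ 0 := inner_self_ne_zero.2 (hk r hr0 hr1)
    obtain ⟨χ, hχ⟩ := exists_character_of_eigenvector (hk r hr0 hr1)
      fun T hT => let ⟨c, hc⟩ := h T hT; ⟨r * c, hc r hr0 hr1⟩
    exact ⟨χ, fun T hT c hc => mul_right_cancel₀ hkk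
      ((hχ (closedAlgebraGen T hT) (k r)).symm.trans (hc r hr0 hr1 (k r)))⟩
  choose χ hχ using h1
  let l : Filter (Set.Ioo (0 : ℝ) 1) := Filter.comap Subtype.val (𝓝 1)
  have hl : l.NeBot := by
    refine mem_closure_iff_comap_neBot.1 ?_
    rw [closure_Ioo (by norm_num)]
    simp
  -- The character space is compact, so the characters at r converge along any ultrafilter with r →
  -- 1; the limit has values lim r c = c on generators.
  let u : Ultrafilter (Set.Ioo (0 : ℝ) 1) := Ultrafilter.of l
  have hu : (u : Filter (Set.Ioo (0 : ℝ) 1)) ≤ l := Ultrafilter.of_le l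
  obtain ⟨ψ, hψ⟩ : ∃ ψ, Filter.Tendsto χ u (𝓝 ψ) := ⟨_, Ultrafilter.le_nhds_lim (u.map χ)⟩
  refine ⟨ψ, fun T hT c hc => ?_⟩
  have h2 : Filter.Tendsto (fun r => χ r (closedAlgebraGen T hT)) u
      (𝓝 (ψ (closedAlgebraGen T hT))) := ((continuous_character_apply _).tendsto ψ).comp hψ
  have h3 : Filter.Tendsto (fun r : Set.Ioo (0 : ℝ) 1 => ((r : ℝ) : ℂ) * c) u
      (𝓝 (((1 : ℝ) : ℂ) * c)) := by
    have h4 : Filter.Tendsto (fun r : Set.Ioo (0 : ℝ) 1 => (r : ℝ)) u (𝓝 1) :=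
      Filter.tendsto_comap.mono_left hu
    exact ((Complex.continuous_ofReal.tendsto 1).comp h4).mul_const _
  simp only [fun r => hχ r T hT c hc] at h2
  rw [tendsto_nhds_unique h2 h3]
  simp

end ClosedAlgebra

/-! ### Coordinates in the full Fock space -/

section Words

variable {Λ : Type*}

open Classical in
theorem basisVec_apply (w v : List Λ) : basisVec w v = if v = w then 1 else 0 := by
  simp [basisVec, lp.single_apply, Pi.single_apply]

theorem inner_basisVec_left (w : List Λ) (y : FullFock Λ) : ⟪basisVec w, y⟫_ℂ = y w := by
  classical
  have := lp.inner_single_left (𝕜 := ℂ) w (1 : ℂ) y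
  rw [basisVec]
  convert this using 1
  simp

theorem orthonormal_basisVec : Orthonormal ℂ (basisVec : List Λ → FullFock Λ) := by
  classical
  rw [orthonormal_iff_ite]
  intro v w
  rw [inner_basisVec_left, basisVec_apply]

theorem fock_ext {x y : FullFock Λ} (h : ∀ w, x w = y w) : x = y :=
  lp.ext (funext h)

/-- The isometry of `ℓ²(ι)` into the full Fock space that maps the standard basis to basis vectors,
along an injective map from `ι` to words. -/
def wordEmb {ι : Type*} (g : ι → List Λ) (hg : Function.Injective g) :
    lp (fun _ : ι => ℂ) 2 →ₗᵢ[ℂ] FullFock Λ :=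
  (orthonormal_basisVec.comp g hg).orthogonalFamily.linearIsometry

section

variable {ι : Type*} {g : ι → List Λ} (hg : Function.Injective g) (x : lp (fun _ : ι => ℂ) 2)

theorem hasSum_wordEmb : HasSum (fun i => x i • basisVec (g i)) (wordEmb g hg x) := by
  have := (orthonormal_basisVec.comp g hg).orthogonalFamily.hasSum_linearIsometry x
  simp only [LinearIsometry.toSpanSingleton_apply, Function.comp_apply] at this
  exact this

theorem hasSum_wordEmb_apply (w : List Λ) :
    HasSum (fun i => x i * basisVec (g i) w) (wordEmb g hg x w) :=
  (lp.evalCLM ℂ (fun _ : List Λ => ℂ) 2 w).hasSum (hasSum_wordEmb hg x)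

theorem wordEmb_apply (i : ι) : wordEmb g hg x (g i) = x i := by
  refine (hasSum_wordEmb_apply hg x (g i)).unique ?_
  convert hasSum_single i ?_ using 1
  · simp [basisVec_apply]
  · intro j hj
    simp [basisVec_apply, hg.ne hj.symm]

theorem wordEmb_apply_of_notMem {w : List Λ} (hw : w ∉ Set.range g) : wordEmb g hg x w = 0 := by
  refine (hasSum_wordEmb_apply hg x w).unique ?_
  convert hasSum_zero with i
  rw [basisVec_apply, if_neg, mul_zero]
  rintro rfl
  exact hw ⟨i, rfl⟩

end

/-- The inclusion of `H` into the full Fock space, as its summand `H^{⊗ 1}`. -/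
def letterEmb : BaseSpace Λ →ₗᵢ[ℂ] FullFock Λ :=
  wordEmb (fun i => [i]) fun _ _ h => by simpa using h

theorem letterEmb_apply (x : BaseSpace Λ) (i : Λ) : letterEmb x [i] = x i :=
  wordEmb_apply (g := fun i : Λ => [i]) _ x i

theorem letterEmb_mem (x : BaseSpace Λ) : letterEmb x ∈ tensorPower Λ 1 := by
  intro w hw
  refine wordEmb_apply_of_notMem (g := fun i : Λ => [i]) _ x ?_
  rintro ⟨i, rfl⟩
  simp at hw

/-- The right creation operator `y ↦ y ⊗ e_w`. -/
def rightCreation (w : List Λ) : FullFock Λ →ₗᵢ[ℂ] FullFock Λ :=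
  wordEmb (fun u => u ++ w) (List.append_left_injective w)

theorem rightCreation_apply_append (w u : List Λ) (y : FullFock Λ) :
    rightCreation w y (u ++ w) = y u :=
  wordEmb_apply (g := fun u => u ++ w) _ y u

theorem rightCreation_apply_of_notMem {w v : List Λ} (y : FullFock Λ)
    (hv : v ∉ Set.range fun u => u ++ w) : rightCreation w y v = 0 :=
  wordEmb_apply_of_notMem _ y hv

theorem rightCreation_vacuum (w : List Λ) : rightCreation w (vacuum Λ) = basisVec w := by
  refine fock_ext fun v => ?_
  by_cases hv : v ∈ Set.range fun u => u ++ w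
  · obtain ⟨u, rfl⟩ := hv
    simp [rightCreation_apply_append, vacuum, basisVec_apply]
  · rw [rightCreation_apply_of_notMem _ hv, basisVec_apply, if_neg]
    rintro rfl
    exact hv ⟨[], rfl⟩

/-! ### Creation operators -/

@[simp]
theorem creation_apply_nil (ξ y : FullFock Λ) : creation ξ y [] = 0 := rfl

@[simp]
theorem creation_apply_cons (ξ y : FullFock Λ) (i : Λ) (u : List Λ) :
    creation ξ y (i :: u) = ξ [i] * y u := rfl

theorem norm_creation_le (ξ : FullFock Λ) : ‖creation ξ‖ ≤ ‖ξ‖ :=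
  LinearMap.mkContinuous_norm_le _ (norm_nonneg ξ) _

theorem creation_add (ξ η : FullFock Λ) : creation (ξ + η) = creation ξ + creation η := by
  refine ContinuousLinearMap.ext fun y => fock_ext fun w => ?_
  cases w with
  | nil => simp
  | cons i u => simp [add_mul]

theorem creation_smul (c : ℂ) (ξ : FullFock Λ) : creation (c • ξ) = c • creation ξ := by
  refine ContinuousLinearMap.ext fun y => fock_ext fun w => ?_
  cases w with
  | nil => simp
  | cons i u => simp [mul_assoc]

theorem basisVec_mem (w : List Λ) : basisVec w ∈ tensorPower Λ w.length := by
  intro v hv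
  rw [basisVec_apply, if_neg]
  rintro rfl
  exact hv rfl

theorem creation_vacuum {ξ : FullFock Λ} (hξ : ξ ∈ tensorPower Λ 1) :
    creation ξ (vacuum Λ) = ξ := by
  refine fock_ext fun w => ?_
  cases w with
  | nil => rw [creation_apply_nil, hξ [] (by simp)]
  | cons i u =>
    rw [creation_apply_cons, vacuum, basisVec_apply]
    split_ifs with hu
    · rw [hu, mul_one]
    · rw [mul_zero, hξ]
      simpa using hu

theorem creation_basisVec (i : Λ) (u : List Λ) :
    creation (basisVec [i]) (basisVec u) = basisVec (i :: u) := by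
  refine fock_ext fun w => ?_
  cases w with
  | nil => simp [basisVec_apply]
  | cons j v =>
    rw [creation_apply_cons]
    simp only [basisVec_apply, List.cons.injEq, and_true]
    split_ifs <;> simp_all

theorem creation_rightCreation (ξ y : FullFock Λ) (w : List Λ) :
    creation ξ (rightCreation w y) = rightCreation w (creation ξ y) := by
  refine fock_ext fun v => ?_
  by_cases hv : v ∈ Set.range fun u => u ++ w
  · obtain ⟨u, rfl⟩ := hv
    simp only [rightCreation_apply_append]
    cases u with
    | nil =>
      rw [creation_apply_nil]
      cases w with
      | nil => rfl
      | cons i w =>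
        -- The remaining word is shorter than the suffix being tensored on the right, so its
        -- coefficient vanishes.
        rw [List.nil_append, creation_apply_cons, rightCreation_apply_of_notMem, mul_zero]
        rintro ⟨u, hu⟩
        have := congrArg List.length hu
        simp only [List.length_append, List.length_cons] at this
        omega
    | cons i u =>
      rw [List.cons_append, creation_apply_cons, rightCreation_apply_append, creation_apply_cons]
  · rw [rightCreation_apply_of_notMem _ hv]
    cases v with
    | nil => rfl
    | cons i u =>
      rw [creation_apply_cons, rightCreation_apply_of_notMem, mul_zero]
      rintro ⟨v, rfl⟩
      exact hv ⟨i :: v, rfl⟩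

theorem inner_vacuum_creation (ξ y : FullFock Λ) : ⟪vacuum Λ, creation ξ y⟫_ℂ = 0 := by
  rw [vacuum, inner_basisVec_left, creation_apply_nil]

theorem hasSum_inner_letterEmb (x : BaseSpace Λ) (ξ : FullFock Λ) :
    HasSum (fun i : Λ => ⟪x i, ξ [i]⟫_ℂ) ⟪letterEmb x, ξ⟫_ℂ := by
  have hinj : Function.Injective fun i : Λ => [i] := fun a b h => by simpa using h
  have h := lp.hasSum_inner (𝕜 := ℂ) (letterEmb x) ξ
  rw [← hinj.hasSum_iff] at h
  · simpa only [Function.comp_def, letterEmb_apply] using h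
  · intro w hw
    rw [letterEmb_mem x w, inner_zero_left]
    intro h
    obtain ⟨i, rfl⟩ := List.length_eq_one_iff.1 h
    exact hw ⟨i, rfl⟩

theorem hasSum_mul_of_hasSum {ι κ : Type*} {f : ι → ℂ} {g : κ → ℂ} {a b : ℂ} (hf : HasSum f a)
    (hg : HasSum g b) : HasSum (fun p : ι × κ => f p.1 * g p.2) (a * b) :=
  hf.mul hg (summable_mul_of_summable_norm hf.summable.norm hg.summable.norm)

/-- The relation L(x)* L(ξ) = ⟪x, ξ⟫ · 1: the sum over words i :: u factors into sums over i and
over u. -/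
theorem inner_creation_creation (x : BaseSpace Λ) (ξ k y : FullFock Λ) :
    ⟪creation (letterEmb x) k, creation ξ y⟫_ℂ = ⟪letterEmb x, ξ⟫_ℂ * ⟪k, y⟫_ℂ := by
  have h3 := hasSum_mul_of_hasSum (hasSum_inner_letterEmb x ξ) (lp.hasSum_inner (𝕜 := ℂ) k y)
  have hc : Function.Injective (fun p : Λ × List Λ => p.1 :: p.2) := by
    rintro ⟨a, u⟩ ⟨b, v⟩ h
    simpa using h
  have h4 := lp.hasSum_inner (𝕜 := ℂ) (creation (letterEmb x) k) (creation ξ y)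
  rw [← hc.hasSum_iff] at h4
  · refine h4.unique ?_
    have h5 : ((fun w => ⟪creation (letterEmb x) k w, creation ξ y w⟫_ℂ) ∘
        fun p : Λ × List Λ => p.1 :: p.2)
        = fun p => ⟪x p.1, ξ [p.1]⟫_ℂ * ⟪k p.2, y p.2⟫_ℂ := by
      funext p
      simp only [Function.comp_apply, creation_apply_cons, letterEmb_apply, RCLike.inner_apply,
        map_mul]
      ring
    rw [h5]
    exact h3
  · intro w hw
    cases w with
    | nil => rw [creation_apply_nil, inner_zero_left]
    | cons i u => exact absurd ⟨(i, u), rfl⟩ hw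

/-! ### The kernel vectors -/

/-- The vector `∑_w conj(z^w) e_w`, for `z` in the open unit ball. -/
def kernelVec (z : BaseSpace Λ) : FullFock Λ :=
  Ring.inverse (1 - creation (letterEmb (star z))) (vacuum Λ)

/-- Since ‖L(star z)‖ ≤ ‖z‖ < 1, `Ring.inverse` is a true inverse here and not its default value.
The recursion gives both the coordinates and the eigenvector property. -/
theorem kernelVec_eq {z : BaseSpace Λ} (hz : ‖z‖ < 1) :
    kernelVec z = vacuum Λ + creation (letterEmb (star z)) (kernelVec z) := by
  have h1 : ‖creation (letterEmb (star z))‖ < 1 :=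
    (norm_creation_le _).trans_lt (by rwa [LinearIsometry.norm_map, norm_star])
  have h2 := Ring.mul_inverse_cancel _ (isUnit_one_sub_of_norm_lt_one h1)
  have h3 := congrArg (fun T : FullFock Λ →L[ℂ] FullFock Λ => T (vacuum Λ)) h2
  exact sub_eq_iff_eq_add.1 h3

theorem kernelVec_apply {z : BaseSpace Λ} (hz : ‖z‖ < 1) (w : List Λ) :
    kernelVec z w = star (w.map fun i => z i).prod := by
  induction w with
  | nil =>
    rw [kernelVec_eq hz]
    simp [vacuum, basisVec_apply]
  | cons i u ih =>
    rw [kernelVec_eq hz]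
    simp [vacuum, basisVec_apply, letterEmb_apply, ih]

theorem kernelVec_ne_zero {z : BaseSpace Λ} (hz : ‖z‖ < 1) : kernelVec z ≠ 0 := by
  intro h
  have := kernelVec_apply hz []
  rw [h] at this
  simp at this

/-- In k = 1 + L(star z) k the vacuum is orthogonal to the range of L(ξ), and L(star z)* L(ξ) is a
scalar. The `star` offsets conjugate linearity in the first slot: the eigenvalue is ∑ z_i ξ_i. -/
theorem inner_kernelVec_creation {z : BaseSpace Λ} (hz : ‖z‖ < 1) (ξ y : FullFock Λ) :
    ⟪kernelVec z, creation ξ y⟫_ℂ = ⟪letterEmb (star z), ξ⟫_ℂ * ⟪kernelVec z, y⟫_ℂ := by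
  conv_lhs => rw [kernelVec_eq hz]
  rw [inner_add_left, inner_vacuum_creation, zero_add, inner_creation_creation]

theorem ballEval_eq_inner {z : BaseSpace Λ} (hz : ‖z‖ < 1) (f : FullFock Λ →L[ℂ] FullFock Λ) :
    ballEval f z = ⟪kernelVec z, f (vacuum Λ)⟫_ℂ := by
  rw [ballEval, lp.inner_eq_tsum]
  refine tsum_congr fun w => ?_
  rw [kernelVec_apply hz]
  simp

theorem norm_real_smul_lt_one {z : BaseSpace Λ} (hz : ‖z‖ ≤ 1) {r : ℝ} (hr0 : 0 < r) (hr1 : r < 1) :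
    ‖(r : ℂ) • z‖ < 1 := by
  rw [norm_smul, Complex.norm_real, Real.norm_of_nonneg hr0.le]
  nlinarith [norm_nonneg z]

theorem inner_letterEmb_star_real_smul (z : BaseSpace Λ) (r : ℝ) (ξ : FullFock Λ) :
    ⟪letterEmb (star ((r : ℂ) • z)), ξ⟫_ℂ = r * ⟪letterEmb (star z), ξ⟫_ℂ := by
  rw [star_smul, map_smul, inner_smul_left]
  simp

/-- Homogeneity of degree n, written symmetrically in r and t because no kernel vector is available
at z itself when ‖z‖ = 1. -/
theorem inner_kernelVec_real_smul {z : BaseSpace Λ} (hz : ‖z‖ ≤ 1) {r t : ℝ} (hr0 : 0 < r)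
    (hr1 : r < 1) (ht0 : 0 < t) (ht1 : t < 1) {n : ℕ} {x : FullFock Λ} (hx : x ∈ tensorPower Λ n) :
    (r : ℂ) ^ n * ⟪kernelVec ((t : ℂ) • z), x⟫_ℂ = (t : ℂ) ^ n * ⟪kernelVec ((r : ℂ) • z), x⟫_ℂ := by
  have key : ∀ (c : ℂ) (w : List Λ),
      (w.map fun i => (c • z) i).prod = c ^ w.length * (w.map fun i => z i).prod := by
    intro c w
    induction w with
    | nil => simp
    | cons i u ih =>
      rw [List.map_cons, List.prod_cons, ih]
      simp [pow_succ]
      ring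
  rw [lp.inner_eq_tsum, lp.inner_eq_tsum, ← tsum_mul_left, ← tsum_mul_left]
  refine tsum_congr fun w => ?_
  by_cases hw : w.length = n
  · rw [kernelVec_apply (norm_real_smul_lt_one hz hr0 hr1),
      kernelVec_apply (norm_real_smul_lt_one hz ht0 ht1), key, key, hw]
    simp
    ring
  · rw [hx w hw]
    simp

/-! ### Characters of the noncommutative disc algebra -/

/-- The creation operator `L(ξ)`, `ξ ∈ H`, as an element of the noncommutative disc algebra. -/
def discGen (ξ : FullFock Λ) (hξ : ξ ∈ tensorPower Λ 1) : discAlgebra Λ :=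
  closedAlgebraGen (creation ξ) ⟨ξ, hξ, rfl⟩

theorem tendsto_discAlgebra_character {α : Type*} {l : Filter α}
    {χ : α → WeakDual.characterSpace ℂ (discAlgebra Λ)}
    {ψ : WeakDual.characterSpace ℂ (discAlgebra Λ)}
    (h : ∀ ξ hξ, Filter.Tendsto (fun a => χ a (discGen ξ hξ)) l (𝓝 (ψ (discGen ξ hξ))))
    (f : discAlgebra Λ) : Filter.Tendsto (fun a => χ a f) l (𝓝 (ψ f)) :=
  tendsto_character (s := {T | ∃ ξ ∈ tensorPower Λ 1, T = creation ξ})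
    (by rintro _ ⟨ξ, hξ, rfl⟩; exact h ξ hξ) f

theorem discAlgebra_character_ext {χ ψ : WeakDual.characterSpace ℂ (discAlgebra Λ)}
    (h : ∀ ξ hξ, χ (discGen ξ hξ) = ψ (discGen ξ hξ)) : χ = ψ :=
  character_ext (s := {T | ∃ ξ ∈ tensorPower Λ 1, T = creation ξ})
    (by rintro _ ⟨ξ, hξ, rfl⟩; exact h ξ hξ)

theorem exists_ballCharacter {z : BaseSpace Λ} (hz : ‖z‖ ≤ 1) :
    ∃ χ : WeakDual.characterSpace ℂ (discAlgebra Λ),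
      ∀ ξ hξ, χ (discGen ξ hξ) = ⟪letterEmb (star z), ξ⟫_ℂ := by
  have key : ∀ (ξ : FullFock Λ) (r : ℝ), 0 < r → r < 1 → ∀ y,
      ⟪kernelVec ((r : ℂ) • z), creation ξ y⟫_ℂ
        = r * ⟪letterEmb (star z), ξ⟫_ℂ * ⟪kernelVec ((r : ℂ) • z), y⟫_ℂ :=
    fun ξ r hr0 hr1 y => by
      rw [inner_kernelVec_creation (norm_real_smul_lt_one hz hr0 hr1),
        inner_letterEmb_star_real_smul]
  obtain ⟨χ, hχ⟩ := exists_character_of_eigenvectors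
    (s := {T | ∃ ξ ∈ tensorPower Λ 1, T = creation ξ}) (k := fun r : ℝ => kernelVec ((r : ℂ) • z))
    (fun r hr0 hr1 => kernelVec_ne_zero (norm_real_smul_lt_one hz hr0 hr1))
    (by
      rintro _ ⟨ξ, hξ, rfl⟩
      exact ⟨_, key ξ⟩)
  exact ⟨χ, fun ξ hξ => hχ _ _ _ (key ξ)⟩

/-- The character `f ↦ f(z)` of the noncommutative disc algebra, for `z` in the closed unit
ball. -/
def ballCharacter (z : BaseSpace Λ) (hz : ‖z‖ ≤ 1) : WeakDual.characterSpace ℂ (discAlgebra Λ) :=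
  (exists_ballCharacter hz).choose

theorem ballCharacter_discGen {z : BaseSpace Λ} (hz : ‖z‖ ≤ 1) (ξ : FullFock Λ)
    (hξ : ξ ∈ tensorPower Λ 1) : ballCharacter z hz (discGen ξ hξ) = ⟪letterEmb (star z), ξ⟫_ℂ :=
  (exists_ballCharacter hz).choose_spec ξ hξ

/-- `ballCharacter` was chosen through its values on generators; inside the open ball this
identifies it with the eigenvalue character of k_z. -/
theorem inner_kernelVec_apply {z : BaseSpace Λ} (hz : ‖z‖ < 1) (f : discAlgebra Λ)
    (y : FullFock Λ) :
    ⟪kernelVec z, (f : FullFock Λ →L[ℂ] FullFock Λ) y⟫_ℂ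
      = ballCharacter z hz.le f * ⟪kernelVec z, y⟫_ℂ := by
  have hk := kernelVec_ne_zero hz
  have hkk : ⟪kernelVec z, kernelVec z⟫_ℂ ≠ 0 := inner_self_ne_zero.2 hk
  obtain ⟨χ, hχ⟩ := exists_character_of_eigenvector
    (s := {T | ∃ ξ ∈ tensorPower Λ 1, T = creation ξ}) hk (by
      rintro _ ⟨ξ, hξ, rfl⟩
      exact ⟨_, inner_kernelVec_creation hz ξ⟩)
  have : χ = ballCharacter z hz.le := discAlgebra_character_ext fun ξ hξ => by
    rw [ballCharacter_discGen]
    exact mul_right_cancel₀ hkk ((hχ (discGen ξ hξ) (kernelVec z)).symm.trans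
      (inner_kernelVec_creation hz ξ _))
  rw [← this]
  exact hχ f y

theorem ballEval_eq_ballCharacter {z : BaseSpace Λ} (hz : ‖z‖ < 1) (f : discAlgebra Λ) :
    ballEval (f : FullFock Λ →L[ℂ] FullFock Λ) z = ballCharacter z hz.le f := by
  rw [ballEval_eq_inner hz, inner_kernelVec_apply hz, vacuum, ← inner_conj_symm,
    inner_basisVec_left, kernelVec_apply hz]
  simp

theorem tendsto_ballCharacter {α : Type*} {l : Filter α} {z : α → BaseSpace Λ} {z₀ : BaseSpace Λ}
    (hz : ∀ a, ‖z a‖ ≤ 1) (hz₀ : ‖z₀‖ ≤ 1) (h : Filter.Tendsto z l (𝓝 z₀)) (f : discAlgebra Λ) :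
    Filter.Tendsto (fun a => ballCharacter (z a) (hz a) f) l (𝓝 (ballCharacter z₀ hz₀ f)) := by
  refine tendsto_discAlgebra_character (fun ξ hξ => ?_) f
  simp only [ballCharacter_discGen]
  have h2 : Continuous fun x : BaseSpace Λ => ⟪letterEmb (star x), ξ⟫_ℂ := by fun_prop
  exact (h2.tendsto z₀).comp h

/-- z ↦ `ballCharacter z` f is norm continuous on the closed ball and agrees with the power series
inside, so it is the continuous extension. -/
theorem scalarEval_eq_ballCharacter {z : BaseSpace Λ} (hz : ‖z‖ ≤ 1) (f : discAlgebra Λ) :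
    scalarEval (f : FullFock Λ →L[ℂ] FullFock Λ) z = ballCharacter z hz f := by
  refine extendFrom_eq ?_ ?_
  · rw [closure_ball _ one_ne_zero]
    simpa using hz
  · have h : Filter.Tendsto
        (fun x : Metric.ball (0 : BaseSpace Λ) 1 => ballCharacter (x : BaseSpace Λ)
          (mem_ball_zero_iff.1 x.2).le f)
        (Filter.comap Subtype.val (𝓝 z)) (𝓝 (ballCharacter z hz f)) :=
      tendsto_ballCharacter _ hz Filter.tendsto_comap f
    have h' : 𝓝[Metric.ball (0 : BaseSpace Λ) 1] z
        = Filter.map Subtype.val (Filter.comap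
          (Subtype.val : Metric.ball (0 : BaseSpace Λ) 1 → BaseSpace Λ) (𝓝 z)) := by
      rw [Filter.map_comap, Subtype.range_coe, nhdsWithin]
    rw [h', Filter.tendsto_map'_iff]
    refine h.congr fun x => ?_
    exact (ballEval_eq_ballCharacter (mem_ball_zero_iff.1 x.2) f).symm

end Words

section Ideals

variable {Λ : Type*}

/-! ### Homogeneous components of vectors -/

open Classical in
/-- The component of `x` in `H^{⊗ n}`. -/
def component (n : ℕ) (x : FullFock Λ) : FullFock Λ :=
  ⟨fun w => if w.length = n then x w else 0, (lp.memℓp x).mono' fun w => by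
    split_ifs
    · exact le_rfl
    · simp⟩

open Classical in
theorem component_apply (n : ℕ) (x : FullFock Λ) (w : List Λ) :
    component n x w = if w.length = n then x w else 0 := rfl

theorem component_mem (n : ℕ) (x : FullFock Λ) : component n x ∈ tensorPower Λ n := by
  intro w hw
  rw [component_apply, if_neg hw]

theorem inner_component {n : ℕ} {a : FullFock Λ} (ha : a ∈ tensorPower Λ n) (x : FullFock Λ) :
    ⟪a, component n x⟫_ℂ = ⟪a, x⟫_ℂ := by
  rw [lp.inner_eq_tsum, lp.inner_eq_tsum]
  refine tsum_congr fun w => ?_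
  rw [component_apply]
  split_ifs with hw
  · rfl
  · rw [ha w hw, inner_zero_left, inner_zero_left]

theorem inner_eq_zero_of_ne {m n : ℕ} (hmn : m ≠ n) {a b : FullFock Λ} (ha : a ∈ tensorPower Λ m)
    (hb : b ∈ tensorPower Λ n) : ⟪a, b⟫_ℂ = 0 := by
  rw [lp.inner_eq_tsum]
  refine (tsum_congr fun w => ?_).trans tsum_zero
  by_cases hw : w.length = m
  · rw [hb w (hw.trans_ne hmn), inner_zero_right]
  · rw [ha w hw, inner_zero_left]

/-- ⟪x_n, x⟫ = ‖x_n‖². This replaces convergence of the sum of components when closed graded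
subspaces are compared. -/
theorem eq_zero_of_inner_component {x : FullFock Λ} (h : ∀ n, ⟪component n x, x⟫_ℂ = 0) :
    x = 0 := by
  refine fock_ext fun w => ?_
  have h1 : component w.length x = 0 := by
    rw [← inner_self_eq_zero (𝕜 := ℂ), inner_component (component_mem _ _), h]
  have h2 := component_apply w.length x w
  rw [h1, if_pos rfl] at h2
  exact h2.symm

theorem apply_mem_of_basisVec {K : Submodule ℂ (FullFock Λ)} (hK : IsClosed (K : Set (FullFock Λ)))
    (T : FullFock Λ →L[ℂ] FullFock Λ) (h : ∀ w, T (basisVec w) ∈ K) (y : FullFock Λ) :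
    T y ∈ K := by
  classical
  have h1 : HasSum (fun w => lp.single 2 w (y w)) y := lp.hasSum_single (by norm_num) y
  refine hK.mem_of_tendsto (T.hasSum h1) (Filter.Eventually.of_forall fun s => ?_)
  refine K.sum_mem fun w _ => ?_
  have h2 : lp.single 2 w (y w) = y w • basisVec w := by
    refine fock_ext fun v => ?_
    rw [lp.coeFn_smul, Pi.smul_apply, basisVec_apply, lp.single_apply]
    by_cases hv : v = w
    · subst hv
      simp
    · simp [hv]
  rw [h2, map_smul]
  exact K.smul_mem _ (h w)

/-! ### Operators in the noncommutative disc algebra -/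

theorem vacuum_mem : vacuum Λ ∈ tensorPower Λ 0 := basisVec_mem []

theorem discAlgebra_subalgebra_eq_top (A : Subalgebra ℂ (discAlgebra Λ))
    (hA : IsClosed (A : Set (discAlgebra Λ))) (h : ∀ ξ hξ, discGen ξ hξ ∈ A) (f : discAlgebra Λ) :
    f ∈ A :=
  closedAlgebra_subalgebra_eq_top (s := {T | ∃ ξ ∈ tensorPower Λ 1, T = creation ξ}) A hA
    (by rintro _ ⟨ξ, hξ, rfl⟩; exact h ξ hξ) f

/-- Left creation operators commute with right tensoring; in particular f e_w = (f·1) ⊗ e_w. -/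
theorem apply_rightCreation (f : discAlgebra Λ) (w : List Λ) (y : FullFock Λ) :
    (f : FullFock Λ →L[ℂ] FullFock Λ) (rightCreation w y)
      = rightCreation w ((f : FullFock Λ →L[ℂ] FullFock Λ) y) := by
  let A : Subalgebra ℂ (discAlgebra Λ) :=
    { carrier := {f | ∀ y, (f : FullFock Λ →L[ℂ] FullFock Λ) (rightCreation w y)
        = rightCreation w ((f : FullFock Λ →L[ℂ] FullFock Λ) y)}
      mul_mem' := fun {f g} hf hg y => by
        change (f : FullFock Λ →L[ℂ] FullFock Λ) ((g : FullFock Λ →L[ℂ] FullFock Λ) _) = _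
        rw [hg, hf]
        rfl
      add_mem' := fun {f g} hf hg y => by
        change (f : FullFock Λ →L[ℂ] FullFock Λ) _ + (g : FullFock Λ →L[ℂ] FullFock Λ) _ = _
        rw [hg, hf, ← map_add]
        rfl
      algebraMap_mem' := fun c y => ((rightCreation w).map_smul c y).symm }
  refine discAlgebra_subalgebra_eq_top A ?_ (fun ξ hξ y => creation_rightCreation ξ y w) f y
  have hA : (A : Set (discAlgebra Λ)) = ⋂ y : FullFock Λ, {f : discAlgebra Λ |
      (f : FullFock Λ →L[ℂ] FullFock Λ) (rightCreation w y)
        = rightCreation w ((f : FullFock Λ →L[ℂ] FullFock Λ) y)} := by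
    ext f
    simp only [Set.mem_iInter]
    rfl
  rw [hA]
  refine isClosed_iInter fun y => isClosed_eq ?_ ?_ <;> fun_prop

theorem exists_apply_vacuum_eq_basisVec (w : List Λ) :
    ∃ f : discAlgebra Λ, (f : FullFock Λ →L[ℂ] FullFock Λ) (vacuum Λ) = basisVec w := by
  induction w with
  | nil => exact ⟨1, rfl⟩
  | cons i u ih =>
    obtain ⟨f, hf⟩ := ih
    refine ⟨discGen (basisVec [i]) (basisVec_mem [i]) * f, ?_⟩
    change creation (basisVec [i]) ((f : FullFock Λ →L[ℂ] FullFock Λ) (vacuum Λ)) = _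
    rw [hf, creation_basisVec]

/-! ### The vectors of a homogeneous ideal -/

variable (J : TwoSidedIdeal (discAlgebra Λ))

/-- The closed linear span of the vectors `f 1`, with `f` a homogeneous element of `J`. -/
def idealSpace : Submodule ℂ (FullFock Λ) :=
  (Submodule.span ℂ {x : FullFock Λ | ∃ n, ∃ f ∈ J,
    IsHomogeneousOperator n (f : FullFock Λ →L[ℂ] FullFock Λ) ∧
      x = (f : FullFock Λ →L[ℂ] FullFock Λ) (vacuum Λ)}).topologicalClosure

theorem isClosed_idealSpace : IsClosed (idealSpace J : Set (FullFock Λ)) :=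
  Submodule.isClosed_topologicalClosure _

instance : CompleteSpace (idealSpace J) := (isClosed_idealSpace J).completeSpace_coe

variable {J}

theorem apply_vacuum_mem_idealSpace_of_homogeneous {f : discAlgebra Λ} (hf : f ∈ J) {n : ℕ}
    (hn : IsHomogeneousOperator n (f : FullFock Λ →L[ℂ] FullFock Λ)) :
    (f : FullFock Λ →L[ℂ] FullFock Λ) (vacuum Λ) ∈ idealSpace J :=
  Submodule.le_topologicalClosure _ (Submodule.subset_span ⟨n, f, hf, hn, rfl⟩)

theorem apply_vacuum_mem_tensorPower {f : FullFock Λ →L[ℂ] FullFock Λ} {n : ℕ}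
    (hn : IsHomogeneousOperator n f) : f (vacuum Λ) ∈ tensorPower Λ n := by
  have := hn 0 _ vacuum_mem
  rwa [zero_add] at this

theorem map_idealSpace (T : FullFock Λ →L[ℂ] FullFock Λ)
    (h : ∀ f ∈ J, ∀ n, IsHomogeneousOperator n (f : FullFock Λ →L[ℂ] FullFock Λ) →
      T ((f : FullFock Λ →L[ℂ] FullFock Λ) (vacuum Λ)) ∈ idealSpace J)
    {x : FullFock Λ} (hx : x ∈ idealSpace J) : T x ∈ idealSpace J := by
  have hle : idealSpace J ≤ (idealSpace J).comap T.toLinearMap := by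
    refine Submodule.topologicalClosure_minimal _ (Submodule.span_le.2 ?_)
      ((isClosed_idealSpace J).preimage T.continuous)
    rintro _ ⟨n, f, hf, hn, rfl⟩
    exact h f hf n hn
  exact hle hx

theorem mem_idealSpace_orthogonal_iff {x : FullFock Λ} :
    x ∈ (idealSpace J)ᗮ ↔ ∀ n, ∀ f ∈ J,
      IsHomogeneousOperator n (f : FullFock Λ →L[ℂ] FullFock Λ) →
        ⟪(f : FullFock Λ →L[ℂ] FullFock Λ) (vacuum Λ), x⟫_ℂ = 0 := by
  constructor
  · intro hx n f hf hn
    exact hx _ (apply_vacuum_mem_idealSpace_of_homogeneous hf hn)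
  · intro h
    rw [idealSpace, Submodule.orthogonal_closure]
    have hle : Submodule.span ℂ {x : FullFock Λ | ∃ n, ∃ f ∈ J,
        IsHomogeneousOperator n (f : FullFock Λ →L[ℂ] FullFock Λ) ∧
          x = (f : FullFock Λ →L[ℂ] FullFock Λ) (vacuum Λ)} ≤ (Submodule.span ℂ {x})ᗮ := by
      refine Submodule.span_le.2 ?_
      rintro _ ⟨n, f, hf, hn, rfl⟩
      exact Submodule.mem_orthogonal_singleton_iff_inner_left.2 (h n f hf hn)
    intro u hu
    exact Submodule.mem_orthogonal_singleton_iff_inner_left.1 (hle hu)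

/-- Elements of J of degree other than n impose no condition on a vector of degree n, so one space K
serves for all fibres. -/
theorem mem_idealFibre_iff {n : ℕ} {x : FullFock Λ} :
    x ∈ idealFibre J n ↔ x ∈ tensorPower Λ n ∧ x ∈ (idealSpace J)ᗮ := by
  have h0 : x ∈ idealFibre J n ↔ x ∈ tensorPower Λ n ∧
      x ∈ (Submodule.span ℂ {x : FullFock Λ | ∃ f ∈ J,
        IsHomogeneousOperator n (f : FullFock Λ →L[ℂ] FullFock Λ) ∧
          x = (f : FullFock Λ →L[ℂ] FullFock Λ) (vacuum Λ)})ᗮ := Iff.rfl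
  rw [h0]
  refine and_congr_right fun hx => ?_
  rw [mem_idealSpace_orthogonal_iff]
  constructor
  · intro h m f hf hm
    by_cases hmn : m = n
    · subst hmn
      exact h _ (Submodule.subset_span ⟨f, hf, hm, rfl⟩)
    · exact inner_eq_zero_of_ne hmn (apply_vacuum_mem_tensorPower hm) hx
  · intro h
    have hle : Submodule.span ℂ {x : FullFock Λ | ∃ f ∈ J,
        IsHomogeneousOperator n (f : FullFock Λ →L[ℂ] FullFock Λ) ∧
          x = (f : FullFock Λ →L[ℂ] FullFock Λ) (vacuum Λ)} ≤ idealSpace J := by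
      refine Submodule.span_le.2 ?_
      rintro _ ⟨f, hf, hn, rfl⟩
      exact apply_vacuum_mem_idealSpace_of_homogeneous hf hn
    exact Submodule.orthogonal_le hle (mem_idealSpace_orthogonal_iff.2 h)

theorem component_mem_idealFibre {x : FullFock Λ} (hx : x ∈ (idealSpace J)ᗮ) (n : ℕ) :
    component n x ∈ idealFibre J n := by
  refine mem_idealFibre_iff.2 ⟨component_mem n x, mem_idealSpace_orthogonal_iff.2 ?_⟩
  intro m f hf hm
  by_cases hmn : m = n
  · subst hmn
    rw [inner_component (apply_vacuum_mem_tensorPower hm)]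
    exact mem_idealSpace_orthogonal_iff.1 hx m f hf hm
  · exact inner_eq_zero_of_ne hmn (apply_vacuum_mem_tensorPower hm) (component_mem n x)

theorem idealFibre_le_fockSpace (n : ℕ) :
    (idealFibre J n).toSubmodule ≤ fockSpace (idealFibre J) :=
  (le_iSup (fun n => (idealFibre J n).toSubmodule) n).trans (Submodule.le_topologicalClosure _)

theorem fockSpace_le : fockSpace (idealFibre J) ≤ (idealSpace J)ᗮ :=
  Submodule.topologicalClosure_minimal _
    (iSup_le fun _ _ hx => (mem_idealFibre_iff.1 hx).2) (Submodule.isClosed_orthogonal _)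

/-- The Fock space of `X^J` is the orthogonal complement of the vectors of `J`. -/
theorem fockSpace_eq : fockSpace (idealFibre J) = (idealSpace J)ᗮ := by
  refine le_antisymm fockSpace_le fun x hx => ?_
  set C := fockSpace (idealFibre J) with hC
  set v := x - C.starProjection x with hv
  have hvC : v ∈ Cᗮ := Submodule.sub_starProjection_mem_orthogonal x
  have hvJ : v ∈ (idealSpace J)ᗮ :=
    Submodule.sub_mem _ hx (fockSpace_le (Submodule.starProjection_apply_mem _ _))
  have hv0 : v = 0 := eq_zero_of_inner_component fun n =>
    hvC _ (idealFibre_le_fockSpace n (component_mem_idealFibre hvJ n))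
  rw [sub_eq_zero.1 (hv.symm.trans hv0)]
  exact Submodule.starProjection_apply_mem _ _

theorem fockSpace_orthogonal : (fockSpace (idealFibre J))ᗮ = idealSpace J := by
  rw [fockSpace_eq, Submodule.orthogonal_orthogonal]

/-- Homogeneity of J enters here: each component of f·1 is g·1 for a homogeneous g in J. The part v
of f·1 orthogonal to K then has ⟪v_n, v⟫ = ⟪v_n, (f·1)_n⟫ = 0. -/
theorem apply_vacuum_mem_idealSpace (hJ : IsHomogeneousIdeal J) {f : discAlgebra Λ} (hf : f ∈ J) :
    (f : FullFock Λ →L[ℂ] FullFock Λ) (vacuum Λ) ∈ idealSpace J := by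
  set x := (f : FullFock Λ →L[ℂ] FullFock Λ) (vacuum Λ) with hx
  set K := idealSpace J with hK
  set v := x - K.starProjection x with hv
  have hvK : v ∈ Kᗮ := Submodule.sub_starProjection_mem_orthogonal x
  have hv0 : v = 0 := by
    refine eq_zero_of_inner_component fun n => ?_
    have h1 : component n v ∈ Kᗮ := (mem_idealFibre_iff.1 (component_mem_idealFibre hvK n)).2
    have h2 : component n x ∈ K := by
      obtain ⟨g, hg, hgn, hgf⟩ := hJ f hf n
      have : component n x = (g : FullFock Λ →L[ℂ] FullFock Λ) (vacuum Λ) := by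
        refine fock_ext fun w => ?_
        rw [component_apply]
        split_ifs with hw
        · rw [hgf 0 _ vacuum_mem w (by rw [hw, zero_add])]
        · rw [apply_vacuum_mem_tensorPower hgn w hw]
      rw [this]
      exact apply_vacuum_mem_idealSpace_of_homogeneous hg hgn
    rw [hv, inner_sub_right, Submodule.inner_left_of_mem_orthogonal
      (Submodule.starProjection_apply_mem _ _) h1, sub_zero,
      ← inner_component (component_mem n v),
      Submodule.inner_left_of_mem_orthogonal h2 h1]
  rw [sub_eq_zero.1 (hv.symm.trans hv0)]
  exact Submodule.starProjection_apply_mem _ _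

/-- Writing e_w = g·1 gives f e_w = (f g)·1, and f g is in J because J is a right ideal. -/
theorem apply_mem_idealSpace_of_mem (hJ : IsHomogeneousIdeal J) {f : discAlgebra Λ} (hf : f ∈ J)
    (y : FullFock Λ) : (f : FullFock Λ →L[ℂ] FullFock Λ) y ∈ idealSpace J := by
  refine apply_mem_of_basisVec (isClosed_idealSpace J) _ (fun w => ?_) y
  obtain ⟨g, hg⟩ := exists_apply_vacuum_eq_basisVec w
  rw [← hg]
  exact apply_vacuum_mem_idealSpace hJ (J.mul_mem_right f g hf)

theorem rightCreation_mem_idealSpace (hJ : IsHomogeneousIdeal J) (w : List Λ) {x : FullFock Λ}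
    (hx : x ∈ idealSpace J) : rightCreation w x ∈ idealSpace J := by
  refine map_idealSpace (rightCreation w).toContinuousLinearMap (fun f hf n _ => ?_) hx
  change rightCreation w _ ∈ _
  rw [← apply_rightCreation]
  exact apply_mem_idealSpace_of_mem hJ hf _

theorem creation_mem_idealSpace_of_mem (hJ : IsHomogeneousIdeal J) {η : FullFock Λ}
    (hη : η ∈ tensorPower Λ 1) (hη' : η ∈ idealSpace J) (y : FullFock Λ) :
    creation η y ∈ idealSpace J := by
  refine apply_mem_of_basisVec (isClosed_idealSpace J) _ (fun w => ?_) y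
  rw [← rightCreation_vacuum, creation_rightCreation, creation_vacuum hη]
  exact rightCreation_mem_idealSpace hJ w hη'

/-- Here J is used as a left ideal: f (g·1) = (f g)·1. -/
theorem apply_mem_idealSpace (hJ : IsHomogeneousIdeal J) (f : discAlgebra Λ) {x : FullFock Λ}
    (hx : x ∈ idealSpace J) : (f : FullFock Λ →L[ℂ] FullFock Λ) x ∈ idealSpace J := by
  refine map_idealSpace _ (fun g hg n _ => ?_) hx
  exact apply_vacuum_mem_idealSpace hJ (J.mul_mem_left f g hg)

/-! ### The compression of the noncommutative disc algebra to the tensor algebra -/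

theorem shift_sub (X : ℕ → ClosedSubmodule ℂ (FullFock Λ)) (ξ η : FullFock Λ) :
    shift X (ξ - η) = shift X ξ - shift X η := by
  have : creation (ξ - η) = creation ξ - creation η := by
    rw [eq_sub_iff_add_eq, ← creation_add, sub_add_cancel]
  rw [shift, shift, shift, this, ContinuousLinearMap.sub_comp, ContinuousLinearMap.comp_sub]

theorem orthogonalProjectionOnto_eq_zero {y : FullFock Λ} (hy : y ∈ idealSpace J) :
    (fockSpace (idealFibre J)).orthogonalProjectionOnto y = 0 :=
  Submodule.orthogonalProjectionOnto_apply_of_mem_orthogonal (by rwa [fockSpace_orthogonal])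

theorem shift_eq_zero {η : FullFock Λ} (h : ∀ y, creation η y ∈ idealSpace J) :
    shift (idealFibre J) η = 0 :=
  ContinuousLinearMap.ext fun y => orthogonalProjectionOnto_eq_zero (h y)

theorem sub_starProjection_mem_idealSpace {n : ℕ} {ξ : FullFock Λ} (hξ : ξ ∈ tensorPower Λ n) :
    ξ - (idealFibre J n).toSubmodule.starProjection ξ ∈ tensorPower Λ n ∧
      ξ - (idealFibre J n).toSubmodule.starProjection ξ ∈ idealSpace J := by
  have hpm : (idealFibre J n).toSubmodule.starProjection ξ ∈ idealFibre J n :=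
    Submodule.starProjection_apply_mem (idealFibre J n).toSubmodule ξ
  have h3 : ξ - (idealFibre J n).toSubmodule.starProjection ξ ∈ (idealFibre J n).toSubmoduleᗮ :=
    Submodule.sub_starProjection_mem_orthogonal ξ
  generalize (idealFibre J n).toSubmodule.starProjection ξ = p at hpm h3
  have h1 : ξ - p ∈ tensorPower Λ n :=
    (tensorPower Λ n).toSubmodule.sub_mem hξ (mem_idealFibre_iff.1 hpm).1
  refine ⟨h1, ?_⟩
  rw [← Submodule.orthogonal_orthogonal (idealSpace J)]
  intro x hx
  rw [inner_eq_zero_symm, ← inner_component h1]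
  exact Submodule.inner_left_of_mem_orthogonal (component_mem_idealFibre hx n) h3

/-- The shift by `ξ` is the shift by the projection of `ξ` to `X₁`. -/
theorem shift_starProjection (hJ : IsHomogeneousIdeal J) {ξ : FullFock Λ}
    (hξ : ξ ∈ tensorPower Λ 1) :
    shift (idealFibre J) ((idealFibre J 1).toSubmodule.starProjection ξ)
      = shift (idealFibre J) ξ := by
  obtain ⟨h1, h2⟩ := sub_starProjection_mem_idealSpace (J := J) hξ
  have h3 := shift_eq_zero (creation_mem_idealSpace_of_mem hJ h1 h2)
  rw [shift_sub, sub_eq_zero] at h3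
  exact h3.symm

/-- The compression of an operator to the Fock space of a family of fibres. -/
def compress (X : ℕ → ClosedSubmodule ℂ (FullFock Λ)) (f : FullFock Λ →L[ℂ] FullFock Λ) :
    fockSpace X →L[ℂ] fockSpace X :=
  (fockSpace X).orthogonalProjectionOnto ∘L f ∘L (fockSpace X).subtypeL

/-- With P the projection onto F_X, invariance of F_Xᗮ = K gives P f (1 - P) = 0, hence P f g P = P
f P g P. -/
theorem compress_mul (hJ : IsHomogeneousIdeal J) (f g : discAlgebra Λ) :
    compress (idealFibre J) ((f * g : discAlgebra Λ) : FullFock Λ →L[ℂ] FullFock Λ)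
      = compress (idealFibre J) f * compress (idealFibre J) g := by
  refine ContinuousLinearMap.ext fun y => ?_
  have h1 := Submodule.sub_starProjection_mem_orthogonal (K := fockSpace (idealFibre J))
    ((g : FullFock Λ →L[ℂ] FullFock Λ) (y : FullFock Λ))
  have h2 := fun x (hx : x ∈ (fockSpace (idealFibre J))ᗮ) =>
    show (f : FullFock Λ →L[ℂ] FullFock Λ) x ∈ (fockSpace (idealFibre J))ᗮ by
      rw [fockSpace_orthogonal] at hx ⊢
      exact apply_mem_idealSpace hJ f hx
  have h3 := Submodule.orthogonalProjectionOnto_apply_of_mem_orthogonal (h2 _ h1)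
  rw [map_sub, map_sub, sub_eq_zero] at h3
  exact h3

/-- The compression of the noncommutative disc algebra, as a homomorphism of algebras. -/
def compressHom (hJ : IsHomogeneousIdeal J) :
    discAlgebra Λ →ₐ[ℂ] (fockSpace (idealFibre J) →L[ℂ] fockSpace (idealFibre J)) :=
  AlgHom.ofLinearMap
    { toFun := fun f => compress (idealFibre J) (f : FullFock Λ →L[ℂ] FullFock Λ)
      map_add' := fun f g => by
        refine ContinuousLinearMap.ext fun y => ?_
        exact map_add (fockSpace (idealFibre J)).orthogonalProjectionOnto _ _
      map_smul' := fun c f => by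
        refine ContinuousLinearMap.ext fun y => ?_
        exact map_smul (fockSpace (idealFibre J)).orthogonalProjectionOnto c _ }
    (ContinuousLinearMap.ext fun y => Submodule.orthogonalProjectionOnto_mem_subspace_eq_self y)
    (compress_mul hJ)

theorem continuous_compressHom (hJ : IsHomogeneousIdeal J) : Continuous (compressHom hJ) := by
  change Continuous fun f : discAlgebra Λ => compress (idealFibre J)
    (f : FullFock Λ →L[ℂ] FullFock Λ)
  unfold compress
  fun_prop

theorem shift_mem_tensorAlgebra (hJ : IsHomogeneousIdeal J) {ξ : FullFock Λ}
    (hξ : ξ ∈ tensorPower Λ 1) : shift (idealFibre J) ξ ∈ tensorAlgebra (idealFibre J) := by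
  rw [← shift_starProjection hJ hξ]
  exact subset_closedAlgebra
    ⟨_, Submodule.starProjection_apply_mem (idealFibre J 1).toSubmodule ξ, rfl⟩

theorem compressHom_mem (hJ : IsHomogeneousIdeal J) (f : discAlgebra Λ) :
    compressHom hJ f ∈ tensorAlgebra (idealFibre J) :=
  discAlgebra_subalgebra_eq_top ((tensorAlgebra (idealFibre J)).comap (compressHom hJ))
    (isClosed_closedAlgebra.preimage (continuous_compressHom hJ))
    (fun _ hξ => shift_mem_tensorAlgebra hJ hξ) f

theorem compressHom_eq_zero (hJ : IsHomogeneousIdeal J) {f : discAlgebra Λ} (hf : f ∈ J) :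
    compressHom hJ f = 0 :=
  ContinuousLinearMap.ext fun y =>
    orthogonalProjectionOnto_eq_zero (apply_mem_idealSpace_of_mem hJ hf y)

/-- The canonical homomorphism from the noncommutative disc algebra to the tensor algebra. -/
def toTensorAlgebra (hJ : IsHomogeneousIdeal J) :
    discAlgebra Λ →ₐ[ℂ] tensorAlgebra (idealFibre J) :=
  (compressHom hJ).codRestrict _ (compressHom_mem hJ)

end Ideals

section Characters

variable {Λ : Type*}

instance : CompleteSpace (discAlgebra Λ) :=
  closedAlgebra_completeSpace (s := {T | ∃ ξ ∈ tensorPower Λ 1, T = creation ξ})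

/-! ### The point of the ball defined by a character of the noncommutative disc algebra -/

theorem exists_letterEmb_eq {ξ : FullFock Λ} (hξ : ξ ∈ tensorPower Λ 1) :
    ∃ x : BaseSpace Λ, letterEmb x = ξ := by
  have hm : Memℓp (E := fun _ : Λ => ℂ) (fun i => ξ [i]) 2 := by
    refine memℓp_gen ?_
    simpa using summable_letters ξ
  refine ⟨⟨fun i => ξ [i], hm⟩, fock_ext fun w => ?_⟩
  by_cases hw : w.length = 1
  · obtain ⟨i, rfl⟩ := List.length_eq_one_iff.1 hw
    rw [letterEmb_apply]
  · rw [hξ w hw, letterEmb_mem _ w hw]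

theorem inner_star_right_comm {ι : Type*} (a b : lp (fun _ : ι => ℂ) 2) :
    ⟪a, star b⟫_ℂ = ⟪b, star a⟫_ℂ := by
  rw [lp.inner_eq_tsum, lp.inner_eq_tsum]
  refine tsum_congr fun i => ?_
  simp only [lp.star_apply, RCLike.inner_apply, RCLike.star_def]
  ring

theorem inner_star_left_comm {ι : Type*} (a b : lp (fun _ : ι => ℂ) 2) :
    ⟪star a, b⟫_ℂ = ⟪star b, a⟫_ℂ := by
  rw [← inner_conj_symm, inner_star_right_comm, inner_conj_symm]

theorem inner_letterEmb_basisVec (z : BaseSpace Λ) (i : Λ) :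
    ⟪letterEmb (star z), basisVec [i]⟫_ℂ = z i := by
  rw [← inner_conj_symm, inner_basisVec_left, letterEmb_apply]
  simp

/-- The functional `x ↦ ψ(L(x))` on `H`. -/
def characterFunctional (ψ : WeakDual.characterSpace ℂ (discAlgebra Λ)) :
    BaseSpace Λ →L[ℂ] ℂ :=
  LinearMap.mkContinuous
    { toFun := fun x => ψ (discGen (letterEmb x) (letterEmb_mem x))
      map_add' := fun x y => by
        rw [← map_add]
        congr 1
        refine Subtype.ext ?_
        change creation (letterEmb (x + y)) = creation (letterEmb x) + creation (letterEmb y)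
        rw [map_add, creation_add]
      map_smul' := fun c x => by
        rw [← map_smul]
        congr 1
        refine Subtype.ext ?_
        change creation (letterEmb (c • x)) = c • creation (letterEmb x)
        rw [map_smul, creation_smul] }
    1 fun x => by
      rw [one_mul, ← letterEmb.norm_map x]
      exact (norm_character_apply_le (s := {T | ∃ ξ ∈ tensorPower Λ 1, T = creation ξ}) ψ _).trans
        (norm_creation_le _)

/-- The point `(ψ(L(e_i)))_i` of the closed unit ball of `H`. -/
def characterPoint (ψ : WeakDual.characterSpace ℂ (discAlgebra Λ)) : BaseSpace Λ :=
  star ((InnerProductSpace.toDual ℂ (BaseSpace Λ)).symm (characterFunctional ψ))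

/-- The `star` in `characterPoint` cancels the conjugation in the Riesz identification, so that the
coordinates are ψ(L(e_i)) themselves. -/
theorem inner_star_characterPoint (ψ : WeakDual.characterSpace ℂ (discAlgebra Λ))
    (x : BaseSpace Λ) :
    ⟪star (characterPoint ψ), x⟫_ℂ = ψ (discGen (letterEmb x) (letterEmb_mem x)) := by
  rw [characterPoint, star_star, InnerProductSpace.toDual_symm_apply]
  rfl

theorem norm_characterPoint_le (ψ : WeakDual.characterSpace ℂ (discAlgebra Λ)) :
    ‖characterPoint ψ‖ ≤ 1 := by
  rw [characterPoint, norm_star, LinearIsometryEquiv.norm_map]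
  exact LinearMap.mkContinuous_norm_le _ zero_le_one _

theorem ballCharacter_characterPoint (ψ : WeakDual.characterSpace ℂ (discAlgebra Λ)) :
    ballCharacter (characterPoint ψ) (norm_characterPoint_le ψ) = ψ := by
  refine discAlgebra_character_ext fun ξ hξ => ?_
  obtain ⟨x, rfl⟩ := exists_letterEmb_eq hξ
  rw [ballCharacter_discGen, LinearIsometry.inner_map_map, inner_star_characterPoint]

theorem ballCharacter_basisVec {z : BaseSpace Λ} (hz : ‖z‖ ≤ 1) (i : Λ) :
    ballCharacter z hz (discGen (basisVec [i]) (basisVec_mem [i])) = z i := by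
  rw [ballCharacter_discGen, inner_letterEmb_basisVec]

theorem characterPoint_apply (ψ : WeakDual.characterSpace ℂ (discAlgebra Λ)) (i : Λ) :
    characterPoint ψ i = ψ (discGen (basisVec [i]) (basisVec_mem [i])) := by
  conv_rhs => rw [← ballCharacter_characterPoint ψ]
  rw [ballCharacter_basisVec]

theorem characterPoint_ballCharacter {z : BaseSpace Λ} (hz : ‖z‖ ≤ 1) :
    characterPoint (ballCharacter z hz) = z := by
  refine lp.ext (funext fun i => ?_)
  rw [characterPoint_apply, ballCharacter_basisVec]

/-! ### Characters of the tensor algebra -/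

variable {J : TwoSidedIdeal (discAlgebra Λ)} (hJ : IsHomogeneousIdeal J)

/-- The image of `L(ξ)`, `ξ ∈ H`, in the tensor algebra. -/
def tensorGen (ξ : FullFock Λ) (hξ : ξ ∈ tensorPower Λ 1) : tensorAlgebra (idealFibre J) :=
  toTensorAlgebra hJ (discGen ξ hξ)

theorem shiftGen_eq_tensorGen (i : Λ) :
    shiftGen (idealFibre J) i = tensorGen hJ (basisVec [i]) (basisVec_mem [i]) :=
  Subtype.ext (shift_starProjection hJ (basisVec_mem [i]))

theorem continuous_tensorAlgebra_character_apply (f : tensorAlgebra (idealFibre J)) :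
    Continuous fun χ : WeakDual.characterSpace ℂ (tensorAlgebra (idealFibre J)) => χ f :=
  (WeakDual.eval_continuous f).comp continuous_subtype_val

theorem tendsto_tensorAlgebra_character {α : Type*} {l : Filter α}
    {χ : α → WeakDual.characterSpace ℂ (tensorAlgebra (idealFibre J))}
    {ψ : WeakDual.characterSpace ℂ (tensorAlgebra (idealFibre J))}
    (h : ∀ ξ hξ, Filter.Tendsto (fun a => χ a (tensorGen hJ ξ hξ)) l (𝓝 (ψ (tensorGen hJ ξ hξ))))
    (f : tensorAlgebra (idealFibre J)) : Filter.Tendsto (fun a => χ a f) l (𝓝 (ψ f)) :=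
  tendsto_character (s := {T | ∃ ξ ∈ idealFibre J 1, T = shift (idealFibre J) ξ})
    (by rintro _ ⟨ξ, hξ, rfl⟩; exact h ξ (mem_idealFibre_iff.1 hξ).1) f

theorem tensorAlgebra_character_ext
    {χ ψ : WeakDual.characterSpace ℂ (tensorAlgebra (idealFibre J))}
    (h : ∀ ξ hξ, χ (tensorGen hJ ξ hξ) = ψ (tensorGen hJ ξ hξ)) : χ = ψ :=
  character_ext (s := {T | ∃ ξ ∈ idealFibre J 1, T = shift (idealFibre J) ξ})
    (by rintro _ ⟨ξ, hξ, rfl⟩; exact h ξ (mem_idealFibre_iff.1 hξ).1)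

/-- The character of the noncommutative disc algebra induced by a character of the tensor
algebra. -/
def pullback (χ : WeakDual.characterSpace ℂ (tensorAlgebra (idealFibre J))) :
    WeakDual.characterSpace ℂ (discAlgebra Λ) :=
  WeakDual.CharacterSpace.equivAlgHom.symm
    ((WeakDual.CharacterSpace.toAlgHom χ).comp (toTensorAlgebra hJ))

theorem pullback_apply (χ : WeakDual.characterSpace ℂ (tensorAlgebra (idealFibre J)))
    (f : discAlgebra Λ) : pullback hJ χ f = χ (toTensorAlgebra hJ f) := rfl

theorem pullback_apply_of_mem (χ : WeakDual.characterSpace ℂ (tensorAlgebra (idealFibre J)))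
    {f : discAlgebra Λ} (hf : f ∈ J) : pullback hJ χ f = 0 := by
  have h : toTensorAlgebra hJ f = 0 := Subtype.ext (compressHom_eq_zero hJ hf)
  rw [pullback_apply, h, map_zero]

/-- Surjectivity of 𝔄_d → 𝒜_X is not needed, only that the images of the L(ξ) generate. -/
theorem pullback_injective : Function.Injective (pullback hJ) := fun _ _ h =>
  tensorAlgebra_character_ext hJ fun ξ hξ => congrArg (fun φ => φ (discGen ξ hξ)) h

/-- For n-homogeneous f in J one has f(tz) = t^n c with c = ⟪k_{rz}, f·1⟫ / r^n independent of t.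
Letting t → 1 gives c = f(z) = 0. -/
theorem kernelVec_real_smul_mem_fockSpace {z : BaseSpace Λ} (hz : ‖z‖ ≤ 1)
    (h : ∀ f ∈ J, ballCharacter z hz f = 0) {r : ℝ} (hr0 : 0 < r) (hr1 : r < 1) :
    kernelVec ((r : ℂ) • z) ∈ fockSpace (idealFibre J) := by
  rw [fockSpace_eq, mem_idealSpace_orthogonal_iff]
  intro n f hf hn
  set x := (f : FullFock Λ →L[ℂ] FullFock Λ) (vacuum Λ) with hx
  have hr : (r : ℂ) ^ n ≠ 0 := pow_ne_zero _ (Complex.ofReal_ne_zero.2 hr0.ne')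
  rw [inner_eq_zero_symm]
  have h1 : ∀ t : Set.Ioo (0 : ℝ) 1, ballCharacter (((t : ℝ) : ℂ) • z)
      (norm_real_smul_lt_one hz t.2.1 t.2.2).le f
        = ((t : ℝ) : ℂ) ^ n * (⟪kernelVec ((r : ℂ) • z), x⟫_ℂ / (r : ℂ) ^ n) := by
    rintro ⟨t, ht0, ht1⟩
    rw [← ballEval_eq_ballCharacter (norm_real_smul_lt_one hz ht0 ht1),
      ballEval_eq_inner (norm_real_smul_lt_one hz ht0 ht1), mul_div_assoc', eq_div_iff hr, mul_comm,
      inner_kernelVec_real_smul hz hr0 hr1 ht0 ht1 (apply_vacuum_mem_tensorPower hn)]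
  let l : Filter (Set.Ioo (0 : ℝ) 1) := Filter.comap Subtype.val (𝓝 1)
  have hl : l.NeBot := by
    refine mem_closure_iff_comap_neBot.1 ?_
    rw [closure_Ioo (by norm_num)]
    simp
  have h2 : Filter.Tendsto (fun t : Set.Ioo (0 : ℝ) 1 => ((t : ℝ) : ℂ)) l (𝓝 ((1 : ℝ) : ℂ)) :=
    (Complex.continuous_ofReal.tendsto 1).comp Filter.tendsto_comap
  rw [Complex.ofReal_one] at h2
  have h3 := tendsto_ballCharacter (l := l) (z := fun t => ((t : ℝ) : ℂ) • z) (z₀ := z)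
    (fun t => (norm_real_smul_lt_one hz t.2.1 t.2.2).le) hz
    (by simpa using h2.smul_const z) f
  simp only [h1, h f hf] at h3
  have h4 := tendsto_nhds_unique h3 ((h2.pow n).mul_const _)
  rw [one_pow, one_mul] at h4
  exact (div_eq_zero_iff.1 h4.symm).resolve_right hr

theorem exists_pullback_eq {z : BaseSpace Λ} (hz : ‖z‖ ≤ 1)
    (h : ∀ f ∈ J, ballCharacter z hz f = 0) : ∃ χ, pullback hJ χ = ballCharacter z hz := by
  classical
  let k : ℝ → fockSpace (idealFibre J) := fun r =>
    if hr : 0 < r ∧ r < 1 then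
      ⟨kernelVec ((r : ℂ) • z), kernelVec_real_smul_mem_fockSpace hz h hr.1 hr.2⟩
    else 0
  have hk : ∀ r, 0 < r → r < 1 → (k r : FullFock Λ) = kernelVec ((r : ℂ) • z) := by
    intro r hr0 hr1
    simp only [k, dif_pos (And.intro hr0 hr1)]
  have key : ∀ (ξ : FullFock Λ) (r : ℝ), 0 < r → r < 1 → ∀ y : fockSpace (idealFibre J),
      ⟪k r, shift (idealFibre J) ξ y⟫_ℂ
        = r * ⟪letterEmb (star z), ξ⟫_ℂ * ⟪k r, y⟫_ℂ := fun ξ r hr0 hr1 y => by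
    -- As k r lies in F_X, the projection in the shift drops out of the inner product.
    have h1 : ⟪k r, shift (idealFibre J) ξ y⟫_ℂ = ⟪(k r : FullFock Λ), creation ξ y⟫_ℂ :=
      Submodule.inner_orthogonalProjectionOnto_eq_of_mem_left (k r) _
    rw [h1, Submodule.coe_inner, hk r hr0 hr1,
      inner_kernelVec_creation (norm_real_smul_lt_one hz hr0 hr1), inner_letterEmb_star_real_smul]
  obtain ⟨χ, hχ⟩ := exists_character_of_eigenvectors
    (s := {T | ∃ ξ ∈ idealFibre J 1, T = shift (idealFibre J) ξ}) (k := k)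
    (fun r hr0 hr1 h0 => kernelVec_ne_zero (norm_real_smul_lt_one hz hr0 hr1) (by
      rw [← hk r hr0 hr1, h0]
      rfl))
    (by
      rintro _ ⟨ξ, hξ, rfl⟩
      exact ⟨_, key ξ⟩)
  refine ⟨χ, discAlgebra_character_ext fun ξ hξ => ?_⟩
  rw [ballCharacter_discGen]
  -- ξ is any vector of H; S(ξ) counts as a generator because it equals S(p₁ξ).
  exact hχ (shift (idealFibre J) ξ)
    ⟨_, Submodule.starProjection_apply_mem (idealFibre J 1).toSubmodule ξ,
      (shift_starProjection hJ hξ).symm⟩ _ (key ξ)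

/-! ### The homeomorphism -/

theorem mem_zeroSet_iff (z : WeakSpace ℂ (BaseSpace Λ)) :
    z ∈ zeroSet J ↔ ∃ hz : ‖(toWeakSpace ℂ (BaseSpace Λ)).symm z‖ ≤ 1,
      ∀ f ∈ J, ballCharacter _ hz f = 0 := by
  have h0 : z ∈ zeroSet J ↔
      (toWeakSpace ℂ (BaseSpace Λ)).symm z ∈ Metric.closedBall (0 : BaseSpace Λ) 1 ∧
        ∀ f ∈ J, scalarEval (f : FullFock Λ →L[ℂ] FullFock Λ)
          ((toWeakSpace ℂ (BaseSpace Λ)).symm z) = 0 := Iff.rfl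
  rw [h0, mem_closedBall_zero_iff, ← exists_prop]
  refine exists_congr fun hz => ?_
  simp only [scalarEval_eq_ballCharacter hz]

/-- The bijection of the character space of the tensor algebra onto the scalar zero set. -/
def characterEquiv :
    WeakDual.characterSpace ℂ (tensorAlgebra (idealFibre J)) ≃ zeroSet J :=
  Equiv.ofBijective
    (fun χ => ⟨toWeakSpace ℂ _ (characterPoint (pullback hJ χ)),
      (mem_zeroSet_iff _).2 ⟨norm_characterPoint_le _, fun f hf =>
        (congrArg (fun φ => φ f) (ballCharacter_characterPoint (pullback hJ χ))).trans
          (pullback_apply_of_mem hJ χ hf)⟩⟩) <| by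
    constructor
    · intro χ ψ h
      have h1 : characterPoint (pullback hJ χ) = characterPoint (pullback hJ ψ) :=
        (toWeakSpace ℂ _).injective (congrArg Subtype.val h)
      refine pullback_injective hJ ?_
      rw [← ballCharacter_characterPoint (pullback hJ χ),
        ← ballCharacter_characterPoint (pullback hJ ψ)]
      congr 1
    · rintro ⟨z, hz⟩
      obtain ⟨hz1, hzJ⟩ := (mem_zeroSet_iff z).1 hz
      obtain ⟨χ, hχ⟩ := exists_pullback_eq hJ hz1 hzJ
      refine ⟨χ, Subtype.ext ?_⟩
      change toWeakSpace ℂ _ (characterPoint (pullback hJ χ)) = z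
      rw [hχ, characterPoint_ballCharacter, LinearEquiv.apply_symm_apply]

theorem characterEquiv_apply (χ : WeakDual.characterSpace ℂ (tensorAlgebra (idealFibre J))) :
    (toWeakSpace ℂ (BaseSpace Λ)).symm (characterEquiv hJ χ : WeakSpace ℂ (BaseSpace Λ))
      = characterPoint (pullback hJ χ) := rfl

/-- This formula matches the two topologies: its left sides control weak-* convergence, its right
sides are the weakly continuous functionals on H. -/
theorem apply_tensorGen (χ : WeakDual.characterSpace ℂ (tensorAlgebra (idealFibre J)))
    (x : BaseSpace Λ) :
    χ (tensorGen hJ (letterEmb x) (letterEmb_mem x)) = ⟪star x, (toWeakSpace ℂ (BaseSpace Λ)).symm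
      (characterEquiv hJ χ : WeakSpace ℂ (BaseSpace Λ))⟫_ℂ := by
  rw [characterEquiv_apply, inner_star_left_comm, inner_star_characterPoint]
  rfl

theorem continuous_weakSpace_inner (x : BaseSpace Λ) :
    Continuous fun z : WeakSpace ℂ (BaseSpace Λ) =>
      ⟪x, (toWeakSpace ℂ (BaseSpace Λ)).symm z⟫_ℂ :=
  WeakBilin.eval_continuous (topDualPairing ℂ (BaseSpace Λ)).flip (innerSL ℂ x)

theorem continuous_characterEquiv : Continuous (characterEquiv hJ) := by
  refine Continuous.subtype_mk (WeakBilin.continuous_of_continuous_eval _ fun l => ?_) _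
  obtain ⟨x, rfl⟩ := (InnerProductSpace.toDual ℂ (BaseSpace Λ)).surjective l
  have h := continuous_tensorAlgebra_character_apply
    (tensorGen hJ (letterEmb (star x)) (letterEmb_mem _))
  simp only [apply_tensorGen, star_star] at h
  exact h

/-- Weak convergence of the points is convergence on generators, which contractivity extends to all
of 𝒜_X. -/
theorem continuous_characterEquiv_symm : Continuous (characterEquiv hJ).symm := by
  refine Continuous.subtype_mk (f := fun z => ((characterEquiv hJ).symm z :
    WeakDual ℂ (tensorAlgebra (idealFibre J)))) ?_ _
  refine WeakDual.continuous_of_continuous_eval fun f => ?_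
  rw [continuous_iff_continuousAt]
  intro z
  refine tendsto_tensorAlgebra_character hJ (χ := fun z => (characterEquiv hJ).symm z)
    (fun ξ hξ => ?_) f
  obtain ⟨x, rfl⟩ := exists_letterEmb_eq hξ
  simp only [apply_tensorGen, Equiv.apply_symm_apply]
  exact ((continuous_weakSpace_inner (star x)).comp continuous_subtype_val).tendsto z

end Characters

end FockSpace

end

theorem mainTheorem8 {Λ : Type*} (J : TwoSidedIdeal (FockSpace.discAlgebra Λ))
    (hJ : FockSpace.IsHomogeneousIdeal J) :
    ∃ Φ : WeakDual.characterSpace ℂ (FockSpace.tensorAlgebra (FockSpace.idealFibre J)) ≃ₜ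
        FockSpace.zeroSet J,
      ∀ (χ : WeakDual.characterSpace ℂ (FockSpace.tensorAlgebra (FockSpace.idealFibre J))) (i : Λ),
        (toWeakSpace ℂ (FockSpace.BaseSpace Λ)).symm (Φ χ : WeakSpace ℂ (FockSpace.BaseSpace Λ)) i
          = χ (FockSpace.shiftGen (FockSpace.idealFibre J) i) := by
  refine ⟨⟨FockSpace.characterEquiv hJ, FockSpace.continuous_characterEquiv hJ,
    FockSpace.continuous_characterEquiv_symm hJ⟩, fun χ i => ?_⟩
  change (toWeakSpace ℂ (FockSpace.BaseSpace Λ)).symm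
    (FockSpace.characterEquiv hJ χ : WeakSpace ℂ (FockSpace.BaseSpace Λ)) i = _
  rw [FockSpace.characterEquiv_apply, FockSpace.characterPoint_apply,
    FockSpace.shiftGen_eq_tensorGen hJ]
  rfl
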